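/- Let $N\cong\mathbb Z^n$ be a lattice with dual $M$, let $\Sigma$ be a nonempty finite fan of rational polyhedral cones in $N_{\mathbb R}$ that is smooth (every cone is generated by part of a $\mathbb Z$-basis of $N$; completeness is not assumed), and let $X=X_\Sigma$ be its tropical toric variety, obtained by gluing the charts $U_\sigma=\operatorname{Hom}(\sigma^\vee\cap M,\mathbb T)$, $\sigma\in\Sigma$, where $\mathbb T=\mathbb R\cup\{-\infty\}$. Its inner points form $N_{\mathbb R}\subset X$. A rational function on an open set $U\subseteq X$ is a real-valued function on the inner points of $U$ that near every point of $U$ is, in some chart $U_\sigma$, a difference of two tropical polynomials $\max_m(c_m+x(m))$ with $m$ in a finite nonempty subset of $\sigma^\vee\cap M$ and $c_m\in\mathbb R$. It is regular if near every point of $U$ it is, in some chart, a tropical polynomial minus a $\mathbb Z$-affine function $c+x(m)$ that is finite at all nearby points (so the difference is $\mathbb T$-valued), and invertible if $f$ and $-f$ are both regular. A Cartier divisor is a collection of pairs $(U_\alpha,f_\alpha)$ with $U_\alpha$ open covering $X$, $f_\alpha$ rational on $U_\alpha$, and $f_\alpha-f_\beta$ invertible on $U_\alpha\cap U_\beta$;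 two collections are identified if their union is again a Cartier divisor. A divisor is effective if it has a representative all of whose functions are regular; $E$ is linearly equivalent to $D=\{(V_\beta,g_\beta)\}$ if $E=\{(V_\beta,g_\beta+h)\}$ for some rational function $h$ on $X$; $|D|$ is the set of effective divisors linearly equivalent to $D$. A divisor passes $p$ if a local function $f_\alpha$ with $p\in U_\alpha$ is not invertible in any neighbourhood of $p$. Let $h^0(X,D)\in\mathbb Z_{\ge0}\cup\{\infty\}$ be the least $k$ such that there are $k$ points $p_1,\dots,p_k\in X$ for which no $E\in|D|$ passes all of $p_1,\dots,p_k$, and $\infty$ if there is no such $k$. For a ray $\rho$ of $\Sigma$ let $e_\rho\in N$ be its primitive generator, and let $D_\rho$ be the divisor given on $U_\sigma$ by $x\mapsto x(m_{\rho,\sigma})$ if $\rho\prec\sigma$, where $(m_{\rho,\sigma})_{\rho\prec\sigma}$ in $M$ is a dual frame of $(e_\rho)_{\rho\prec\sigma}$, and by $0$ otherwise. **Proposition.** For every toric divisor $D=\sum_\rho a_\rho D_\rho$, $a_\rho\in\mathbb Z$, on $X$, $$h^0(X,D)=|P_D\cap M|,\qquad P_D=\{m\in M_{\mathbb R}:\langle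 m,e_\rho\rangle+a_\rho\ge0\text{ for all rays }\rho\text{ of }\Sigma\},$$ as elements of $\mathbb Z_{\ge0}\cup\{\infty\}$; in particular $h^0(X,D)=\infty$ exactly when $P_D\cap M$ is infinite. -/

import Mathlib

open scoped Matrix

namespace TropToric

/-! ## Tropical numbers, lattices and cones -/

/-- The tropical semifield `𝕋 = ℝ ∪ {-∞}` with its order topology. The tropical sum is `max`, the
tropical product is `+` (so `⊥` plays the role of `-∞`, and `⊥ + x = ⊥`). -/
abbrev TropNum : Type := WithBot ℝ

variable {n : ℕ}

/-- The embedding `ℤⁿ → ℝⁿ`, used both for `N ⊆ N_ℝ` and for `M ⊆ M_ℝ`. We take `N = ℤⁿ`, and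
`M = Hom(N, ℤ) = ℤⁿ` through the pairing `⟨m, x⟩ = m ⬝ᵥ x`. -/
def toReal (m : Fin n → ℤ) : Fin n → ℝ := fun i => (m i : ℝ)

/-- A rational polyhedral cone: a finite intersection of half spaces `{x | 0 ≤ ⟨a, x⟩}`, `a ∈ ℤⁿ`. -/
def IsRationalPolyhedral (σ : PointedCone ℝ (Fin n → ℝ)) : Prop :=
  ∃ s : Finset (Fin n → ℤ), ∀ x, x ∈ σ ↔ ∀ a ∈ s, 0 ≤ toReal a ⬝ᵥ x

/-- A cone is smooth if it is generated by a subset of a `ℤ`-basis of the lattice. -/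
def IsSmoothCone (σ : PointedCone ℝ (Fin n → ℝ)) : Prop :=
  ∃ (b : Module.Basis (Fin n) ℤ (Fin n → ℤ)) (I : Set (Fin n)),
    σ = PointedCone.hull ℝ ((fun i => toReal (b i)) '' I)

/-- A (nonempty, finite) fan of rational polyhedral cones in `N_ℝ = ℝⁿ`. -/
structure Fan (n : ℕ) where
  cones : Finset (PointedCone ℝ (Fin n → ℝ))
  nonempty : cones.Nonempty
  rational : ∀ σ ∈ cones, IsRationalPolyhedral σ
  face_mem : ∀ σ ∈ cones, ∀ τ : PointedCone ℝ (Fin n → ℝ), τ.IsFaceOf σ → τ ∈ cones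
  inter_face : ∀ σ ∈ cones, ∀ τ ∈ cones, (σ ⊓ τ).IsFaceOf σ ∧ (σ ⊓ τ).IsFaceOf τ

/-- A fan is smooth if all its cones are. -/
def Fan.IsSmooth (Δ : Fan n) : Prop := ∀ σ ∈ Δ.cones, IsSmoothCone σ

/-- The monoid `S_σ = σ^∨ ∩ M`. -/
def dualMonoid (σ : PointedCone ℝ (Fin n → ℝ)) : AddSubmonoid (Fin n → ℤ) where
  carrier := {m | ∀ x ∈ σ, 0 ≤ toReal m ⬝ᵥ x}
  zero_mem' := fun x _ => by
    have h : toReal (0 : Fin n → ℤ) = 0 := by ext i; simp [toReal]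
    rw [h, zero_dotProduct]
  add_mem' := fun {a b} ha hb x hx => by
    have h : toReal (a + b) = toReal a + toReal b := by ext i; simp [toReal]
    rw [h, add_dotProduct]
    exact add_nonneg (ha x hx) (hb x hx)

theorem dualMonoid_anti {τ σ : PointedCone ℝ (Fin n → ℝ)} (h : τ ≤ σ) :
    dualMonoid σ ≤ dualMonoid τ := fun _ hm x hx => hm x (h hx)

/-! ## Tropical toric varieties -/

/-- The tropical affine toric variety `U_σ = Hom(S_σ, 𝕋)`. -/
abbrev AffineToric (σ : PointedCone ℝ (Fin n → ℝ)) : Type := dualMonoid σ →+ TropNum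

/-- `U_σ` has the topology of pointwise convergence; this is the topology induced by `𝕋ᵏ` through
any finite generating system of `S_σ`. -/
instance (σ : PointedCone ℝ (Fin n → ℝ)) : TopologicalSpace (AffineToric σ) :=
  TopologicalSpace.induced (fun x (m : dualMonoid σ) => x m) inferInstance

/-- The inclusion `ι_{τ,σ} : U_τ → U_σ` for `τ ⊆ σ`: restriction of homomorphisms. -/
def AffineToric.incl {τ σ : PointedCone ℝ (Fin n → ℝ)} (h : τ ≤ σ) (z : AffineToric τ) :
    AffineToric σ :=
  z.comp (AddSubmonoid.inclusion (dualMonoid_anti h))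

/-- The disjoint union of the `U_σ`, `σ ∈ Δ`. -/
abbrev Fan.Pieces (Δ : Fan n) : Type := Σ σ : {σ // σ ∈ Δ.cones}, AffineToric σ.1

/-- The gluing relation: `x ∼ y` if both come from a common `z ∈ U_τ`. -/
def Fan.glue (Δ : Fan n) (x y : Δ.Pieces) : Prop :=
  ∃ τ ∈ Δ.cones, ∃ (h₁ : τ ≤ x.1.1) (h₂ : τ ≤ y.1.1) (z : AffineToric τ),
    AffineToric.incl h₁ z = x.2 ∧ AffineToric.incl h₂ z = y.2

/-- The tropical toric variety `X_Δ = (∐ U_σ)/∼`, with the quotient topology. -/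
def Fan.Variety (Δ : Fan n) : Type := Quot Δ.glue

instance (Δ : Fan n) : TopologicalSpace Δ.Variety :=
  inferInstanceAs (TopologicalSpace (Quot Δ.glue))

/-- The canonical map `U_σ → X_Δ`. -/
def Fan.chart (Δ : Fan n) {σ : PointedCone ℝ (Fin n → ℝ)} (hσ : σ ∈ Δ.cones)
    (x : AffineToric σ) : Δ.Variety := Quot.mk _ ⟨⟨σ, hσ⟩, x⟩

/-- `U_σ` as a subset of `X_Δ`. -/
def Fan.chartSet (Δ : Fan n) {σ : PointedCone ℝ (Fin n → ℝ)} (hσ : σ ∈ Δ.cones) :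
    Set Δ.Variety := Set.range (Δ.chart hσ)

/-- The inner point `m ↦ ⟨m, y⟩` of `U_σ` given by `y ∈ N_ℝ`. -/
def AffineToric.inner (σ : PointedCone ℝ (Fin n → ℝ)) (y : Fin n → ℝ) : AffineToric σ where
  toFun m := ((toReal m.1 ⬝ᵥ y : ℝ) : WithBot ℝ)
  map_zero' := by
    have h : toReal (0 : Fin n → ℤ) = 0 := by ext i; simp [toReal]
    simp [h]
  map_add' a b := by
    have h : toReal (a.1 + b.1) = toReal a.1 + toReal b.1 := by ext i; simp [toReal]
    simp [h, add_dotProduct]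

/-- The open dense part of inner points (those with no coordinate `-∞`) of `X_Δ` is `N_ℝ`, embedded
by this map; it does not depend on the cone that is used, see `inner_eq`. -/
noncomputable def Fan.inner (Δ : Fan n) (y : Fin n → ℝ) : Δ.Variety :=
  Δ.chart Δ.nonempty.choose_spec (AffineToric.inner _ y)

theorem Fan.inf_mem (Δ : Fan n) {σ τ : PointedCone ℝ (Fin n → ℝ)} (hσ : σ ∈ Δ.cones)
    (hτ : τ ∈ Δ.cones) : σ ⊓ τ ∈ Δ.cones :=
  Δ.face_mem σ hσ _ (Δ.inter_face σ hσ τ hτ).1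

theorem Fan.inner_eq (Δ : Fan n) {σ : PointedCone ℝ (Fin n → ℝ)} (hσ : σ ∈ Δ.cones)
    (y : Fin n → ℝ) : Δ.inner y = Δ.chart hσ (AffineToric.inner σ y) :=
  Quot.sound ⟨_, Δ.inf_mem Δ.nonempty.choose_spec hσ, inf_le_left, inf_le_right,
    AffineToric.inner _ y, rfl, rfl⟩

/-! ## Rational and regular functions

A rational function is a real valued function of the inner points, that is, a function `f` on
`N_ℝ`, of which only the values at the inner points of the open set in question matter. -/

/-- A tropical polynomial on `U_σ` other than the constant `-∞`: the maximum of finitely many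
`c_m + x(m)`, `m ∈ S_σ`. -/
structure TropPoly (σ : PointedCone ℝ (Fin n → ℝ)) where
  supp : Finset (dualMonoid σ)
  nonempty : supp.Nonempty
  coeff : dualMonoid σ → ℝ

/-- The value of a tropical polynomial at the inner point `y`. -/
noncomputable def TropPoly.eval {σ : PointedCone ℝ (Fin n → ℝ)} (g : TropPoly σ)
    (y : Fin n → ℝ) : ℝ :=
  g.supp.sup' g.nonempty fun m => g.coeff m + toReal m.1 ⬝ᵥ y

/-- `f` is rational at `p`: near `p` it is, in a chart, a difference of tropical polynomials. -/
def IsRationalAt (Δ : Fan n) (f : (Fin n → ℝ) → ℝ) (p : Δ.Variety) : Prop :=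
  ∃ (σ : PointedCone ℝ (Fin n → ℝ)) (hσ : σ ∈ Δ.cones) (V : Set Δ.Variety),
    IsOpen V ∧ p ∈ V ∧ V ⊆ Δ.chartSet hσ ∧
    ∃ g h : TropPoly σ, ∀ y, Δ.inner y ∈ V → f y = g.eval y - h.eval y

/-- `f` is regular at `p`: near `p` it is, in a chart, `g - h` with `g` a tropical polynomial and
`h` a `ℤ`-affine linear function `c + x(m)`. Here `h` has to be finite at all points of the
neighbourhood, boundary points included, so that `g - h` is a `𝕋`-valued function there. -/
def IsRegularAt (Δ : Fan n) (f : (Fin n → ℝ) → ℝ) (p : Δ.Variety) : Prop :=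
  ∃ (σ : PointedCone ℝ (Fin n → ℝ)) (hσ : σ ∈ Δ.cones) (V : Set Δ.Variety),
    IsOpen V ∧ p ∈ V ∧ V ⊆ Δ.chartSet hσ ∧
    ∃ (g : TropPoly σ) (m : dualMonoid σ) (c : ℝ),
      (∀ x : AffineToric σ, Δ.chart hσ x ∈ V → x m ≠ ⊥) ∧
      ∀ y, Δ.inner y ∈ V → f y = g.eval y - (c + toReal m.1 ⬝ᵥ y)

/-- `f` is an invertible regular function near `p`. -/
def IsInvertibleAt (Δ : Fan n) (f : (Fin n → ℝ) → ℝ) (p : Δ.Variety) : Prop :=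
  IsRegularAt Δ f p ∧ IsRegularAt Δ (-f) p

/-! ## Cartier divisors -/

/-- A (representative of a) Cartier divisor: a collection of pairs `(U, f)`, where the open sets `U`
cover `X_Δ` and `f` is a rational function on `U`, such that the difference of any two of the
functions is an invertible regular function on the common domain. -/
structure CartierDivisor (Δ : Fan n) where
  pairs : Set (Set Δ.Variety × ((Fin n → ℝ) → ℝ))
  isOpen : ∀ P ∈ pairs, IsOpen P.1
  cover : ∀ p : Δ.Variety, ∃ P ∈ pairs, p ∈ P.1
  rational : ∀ P ∈ pairs, ∀ p ∈ P.1, IsRationalAt Δ P.2 p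
  compat : ∀ P ∈ pairs, ∀ Q ∈ pairs, ∀ p ∈ P.1 ∩ Q.1, IsInvertibleAt Δ (P.2 - Q.2) p

namespace CartierDivisor

variable {Δ : Fan n}

/-- Two collections define the same divisor if their union is again a Cartier divisor. -/
def Same (D E : CartierDivisor Δ) : Prop :=
  ∀ P ∈ D.pairs, ∀ Q ∈ E.pairs, ∀ p ∈ P.1 ∩ Q.1, IsInvertibleAt Δ (P.2 - Q.2) p

/-- A divisor is effective if it has a representative all of whose functions are regular. -/
def IsEffective (D : CartierDivisor Δ) : Prop :=
  ∃ D' : CartierDivisor Δ, D'.Same D ∧ ∀ P ∈ D'.pairs, ∀ p ∈ P.1, IsRegularAt Δ P.2 p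

/-- `E` is linearly equivalent to `D`: there is a rational function `h` on `X_Δ` such that `E` is
the divisor `D + div h` given by the pairs `(V, g + h)`, `(V, g) ∈ D`. -/
def LinEquiv (E D : CartierDivisor Δ) : Prop :=
  ∃ h : (Fin n → ℝ) → ℝ, (∀ p : Δ.Variety, IsRationalAt Δ h p) ∧
    ∀ P ∈ E.pairs, ∀ Q ∈ D.pairs, ∀ p ∈ P.1 ∩ Q.1, IsInvertibleAt Δ (P.2 - (Q.2 + h)) p

/-- `D` passes `p`, that is `p ∈ supp D`: some local function of `D` is not smooth (not an
invertible regular function) at `p`. -/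
def Passes (D : CartierDivisor Δ) (p : Δ.Variety) : Prop :=
  ∃ P ∈ D.pairs, p ∈ P.1 ∧ ¬ IsInvertibleAt Δ P.2 p

/-- The linear system `|D|`. -/
def linearSystem (D : CartierDivisor Δ) : Set (CartierDivisor Δ) :=
  {E | E.IsEffective ∧ E.LinEquiv D}

/-- `h⁰(X, D)`: the least `k` such that there are `k` points that no `E ∈ |D|` passes all of, and
`∞` if there is no such `k`. -/
noncomputable def h0 (D : CartierDivisor Δ) : ℕ∞ :=
  sInf {K : ℕ∞ | ∃ k : ℕ, K = k ∧
    ∃ p : Fin k → Δ.Variety, ¬ ∃ E ∈ D.linearSystem, ∀ i, E.Passes (p i)}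

end CartierDivisor

/-! ## Rays, primitive generators, dual frames -/

/-- The one-dimensional cones of the fan. -/
abbrev Fan.Ray (Δ : Fan n) : Type :=
  {ρ : PointedCone ℝ (Fin n → ℝ) //
    ρ ∈ Δ.cones ∧ Module.finrank ℝ (Submodule.span ℝ (ρ : Set (Fin n → ℝ))) = 1}

instance (Δ : Fan n) : Finite Δ.Ray :=
  Set.Finite.subset (Finset.finite_toSet Δ.cones) fun _ h => h.1

noncomputable instance (Δ : Fan n) : Fintype Δ.Ray := Fintype.ofFinite _

/-- `e` is the primitive generator of the ray `ρ`: `ρ ∩ N = ℕ e` and `e ≠ 0`. -/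
def IsPrimitiveGenerator (ρ : PointedCone ℝ (Fin n → ℝ)) (e : Fin n → ℤ) : Prop :=
  e ≠ 0 ∧ ∀ m : Fin n → ℤ, toReal m ∈ ρ ↔ ∃ k : ℕ, m = k • e

theorem IsPrimitiveGenerator.unique {ρ : PointedCone ℝ (Fin n → ℝ)} {e e' : Fin n → ℤ}
    (h : IsPrimitiveGenerator ρ e) (h' : IsPrimitiveGenerator ρ e') : e = e' := by
  obtain ⟨k, hk⟩ := (h'.2 e).1 ((h.2 e).2 ⟨1, by simp⟩)
  obtain ⟨l, hl⟩ := (h.2 e').1 ((h'.2 e').2 ⟨1, by simp⟩)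
  have h2 : k * l = 1 := by
    obtain ⟨i, hi⟩ := Function.ne_iff.1 h.1
    have h1 : e i = k * (l * e i) := by
      conv_lhs => rw [hk]
      conv_lhs => rw [hl]
      simp
    have h3 : ((k * l : ℕ) : ℤ) * e i = 1 * e i := by push_cast; linarith
    exact_mod_cast mul_right_cancel₀ hi h3
  rw [hk, Nat.eq_one_of_mul_eq_one_right h2, one_smul]

theorem toReal_add (a b : Fin n → ℤ) : toReal (a + b) = toReal a + toReal b := by
  ext i; simp [toReal]

theorem toReal_neg (a : Fin n → ℤ) : toReal (-a) = -toReal a := by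
  ext i; simp [toReal]

theorem toReal_sub (a b : Fin n → ℤ) : toReal (a - b) = toReal a - toReal b := by
  ext i; simp [toReal]

theorem toReal_dotProduct (a b : Fin n → ℤ) :
    toReal a ⬝ᵥ toReal b = ((a ⬝ᵥ b : ℤ) : ℝ) := by
  simp [toReal, dotProduct]

theorem toReal_injective : Function.Injective (toReal : (Fin n → ℤ) → (Fin n → ℝ)) := by
  intro a b h
  ext i
  have := congrFun h i
  simpa [toReal] using this

/-- Integral dual basis of a lattice basis. -/
theorem exists_dual (b : Module.Basis (Fin n) ℤ (Fin n → ℤ)) :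
    ∃ d : Fin n → (Fin n → ℤ), ∀ i j, d i ⬝ᵥ b j = if i = j then 1 else 0 := by
  refine ⟨fun i k => b.coord i (Pi.single k 1), fun i j => ?_⟩
  have h : b.coord i (b j) = ∑ k, b j k * b.coord i (Pi.single k 1) := by
    conv_lhs => rw [pi_eq_sum_univ' (b j)]
    rw [map_sum]
    refine Finset.sum_congr rfl fun k _ => ?_
    rw [map_smul, smul_eq_mul]
  have h2 : b.coord i (b j) = if i = j then 1 else 0 := by
    simp [Module.Basis.coord_apply, Module.Basis.repr_self, Finsupp.single_apply, eq_comm]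
  rw [← h2, h, dotProduct]
  exact Finset.sum_congr rfl fun k _ => mul_comm _ _

/-- The cone generated by the `b i`, `i ∈ I`. -/
abbrev basisCone (b : Module.Basis (Fin n) ℤ (Fin n → ℤ)) (I : Set (Fin n)) :
    PointedCone ℝ (Fin n → ℝ) :=
  PointedCone.hull ℝ ((fun i => toReal (b i)) '' I)

section BasisCone

variable {b : Module.Basis (Fin n) ℤ (Fin n → ℤ)} {d : Fin n → (Fin n → ℤ)}

theorem mem_basisCone_of_mem {I : Set (Fin n)} {i : Fin n} (hi : i ∈ I) :
    toReal (b i) ∈ basisCone b I := Submodule.subset_span ⟨i, hi, rfl⟩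

theorem mem_basisCone (hd : ∀ i j, d i ⬝ᵥ b j = if i = j then 1 else 0) {I : Set (Fin n)}
    (x : Fin n → ℝ) :
    x ∈ basisCone b I ↔ (∀ i, 0 ≤ toReal (d i) ⬝ᵥ x) ∧ (∀ i, i ∉ I → toReal (d i) ⬝ᵥ x = 0) ∧
      x = ∑ i, (toReal (d i) ⬝ᵥ x) • toReal (b i) := by
  constructor
  · intro hx
    induction hx using Submodule.span_induction with
    | mem x hx =>
      obtain ⟨j, hj, rfl⟩ := hx
      simp only [toReal_dotProduct, hd]
      refine ⟨fun i => ?_, fun i hi => ?_, ?_⟩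
      · split_ifs <;> simp
      · have : i ≠ j := fun h => hi (h ▸ hj)
        simp [this]
      · simp
    | zero => simp
    | add x y _ _ hx hy =>
      refine ⟨fun i => ?_, fun i hi => ?_, ?_⟩
      · rw [dotProduct_add]; exact add_nonneg (hx.1 i) (hy.1 i)
      · rw [dotProduct_add, hx.2.1 i hi, hy.2.1 i hi, add_zero]
      · simp only [dotProduct_add, add_smul, Finset.sum_add_distrib]
        rw [← hx.2.2, ← hy.2.2]
    | smul a x _ hx =>
      have ha : ∀ v : Fin n → ℝ, v ⬝ᵥ (a • x) = (a : ℝ) * (v ⬝ᵥ x) := fun v => by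
        rw [show a • x = (a : ℝ) • x from rfl, dotProduct_smul, smul_eq_mul]
      refine ⟨fun i => ?_, fun i hi => ?_, ?_⟩
      · rw [ha]; exact mul_nonneg a.2 (hx.1 i)
      · rw [ha, hx.2.1 i hi, mul_zero]
      · simp only [ha, mul_smul, ← Finset.smul_sum]
        rw [← hx.2.2]; rfl
  · rintro ⟨h1, h2, h3⟩
    rw [h3]
    refine Submodule.sum_mem _ fun i _ => ?_
    by_cases hi : i ∈ I
    · exact Submodule.smul_mem _ (⟨_, h1 i⟩ : NNReal) (mem_basisCone_of_mem hi)
    · rw [h2 i hi, zero_smul]; exact zero_mem _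

theorem mem_dualMonoid_basisCone {I : Set (Fin n)} (m : Fin n → ℤ) :
    m ∈ dualMonoid (basisCone b I) ↔ ∀ i ∈ I, 0 ≤ m ⬝ᵥ b i := by
  obtain ⟨d, hd⟩ := exists_dual b
  constructor
  · intro h i hi
    have := h _ (mem_basisCone_of_mem (b := b) hi)
    rw [toReal_dotProduct] at this
    exact_mod_cast this
  · intro h x hx
    obtain ⟨h1, h2, h3⟩ := (mem_basisCone hd x).1 hx
    rw [h3, dotProduct_sum]
    refine Finset.sum_nonneg fun i _ => ?_
    rw [dotProduct_smul, toReal_dotProduct, smul_eq_mul]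
    by_cases hi : i ∈ I
    · exact mul_nonneg (h1 i) (by exact_mod_cast h i hi)
    · rw [h2 i hi, zero_mul]

/-- Faces of a smooth cone are generated by a part of the same basis. -/
theorem face_basisCone {I : Set (Fin n)} {F : PointedCone ℝ (Fin n → ℝ)}
    (hF : F.IsFaceOf (basisCone b I)) : ∃ J ⊆ I, F = basisCone b J := by
  obtain ⟨d, hd⟩ := exists_dual b
  refine ⟨{i ∈ I | toReal (b i) ∈ F}, fun i hi => hi.1, le_antisymm ?_ ?_⟩
  · intro x hx
    obtain ⟨h1, h2, h3⟩ := (mem_basisCone hd x).1 (hF.le hx)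
    refine (mem_basisCone hd x).2 ⟨h1, fun i hi => ?_, h3⟩
    by_contra hne
    have hiI : i ∈ I := by
      by_contra h; exact hne (h2 i h)
    have hpos : 0 < toReal (d i) ⬝ᵥ x := lt_of_le_of_ne (h1 i) (Ne.symm hne)
    refine hi ⟨hiI, ?_⟩
    refine hF.mem_of_smul_add_mem (mem_basisCone_of_mem hiI)
      (y := ∑ j ∈ Finset.univ.erase i, (toReal (d j) ⬝ᵥ x) • toReal (b j)) ?_ hpos ?_
    · refine Submodule.sum_mem _ fun j _ => ?_
      by_cases hj : j ∈ I
      · exact Submodule.smul_mem _ (⟨_, h1 j⟩ : NNReal) (mem_basisCone_of_mem hj)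
      · rw [h2 j hj, zero_smul]; exact zero_mem _
    · rw [Finset.add_sum_erase _ (fun j => (toReal (d j) ⬝ᵥ x) • toReal (b j)) (Finset.mem_univ i),
        ← h3]
      exact hx
  · refine Submodule.span_le.2 ?_
    rintro _ ⟨i, hi, rfl⟩
    exact hi.2

theorem isFaceOf_basisCone {I J : Set (Fin n)} (hJ : J ⊆ I) :
    (basisCone b J).IsFaceOf (basisCone b I) := by
  obtain ⟨d, hd⟩ := exists_dual b
  refine ⟨Submodule.span_mono (Set.image_mono hJ), fun {x y a} hx hy ha hxy => ?_⟩
  obtain ⟨h1, h2, h3⟩ := (mem_basisCone hd x).1 hx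
  refine (mem_basisCone hd x).2 ⟨h1, fun i hi => ?_, h3⟩
  have hz := ((mem_basisCone hd _).1 hxy).2.1 i hi
  rw [dotProduct_add, dotProduct_smul, smul_eq_mul] at hz
  have hy1 := ((mem_basisCone hd y).1 hy).1 i
  have := mul_nonneg ha.le (h1 i)
  have h0 : a * (toReal (d i) ⬝ᵥ x) = 0 := by linarith
  exact (mul_eq_zero.1 h0).resolve_left ha.ne'

theorem finrank_basisCone (I : Set (Fin n)) :
    Module.finrank ℝ (Submodule.span ℝ (basisCone b I : Set (Fin n → ℝ))) = I.ncard := by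
  classical
  obtain ⟨d, hd⟩ := exists_dual b
  have hli : LinearIndependent ℝ (fun i => toReal (b i)) := by
    rw [Fintype.linearIndependent_iff]
    intro g hg i
    have := congrArg (fun v => toReal (d i) ⬝ᵥ v) hg
    simpa [dotProduct_sum, dotProduct_smul, toReal_dotProduct, hd] using this
  have hspan : Submodule.span ℝ (basisCone b I : Set (Fin n → ℝ)) =
      Submodule.span ℝ ((fun i => toReal (b i)) '' I) := by
    refine le_antisymm (Submodule.span_le.2 ?_) (Submodule.span_mono Submodule.subset_span)
    exact PointedCone.hull_le_span ℝ _
  rw [hspan, Set.image_eq_range]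
  have h2 : LinearIndependent ℝ (fun i : I => toReal (b i)) := hli.comp _ Subtype.val_injective
  rw [finrank_span_eq_card h2, ← Nat.card_eq_fintype_card, Nat.card_coe_set_eq]

theorem isPrimitiveGenerator_basisCone (j : Fin n) :
    IsPrimitiveGenerator (basisCone b {j}) (b j) := by
  obtain ⟨d, hd⟩ := exists_dual b
  refine ⟨b.ne_zero j, fun m => ⟨fun h => ?_, ?_⟩⟩
  · obtain ⟨h1, h2, h3⟩ := (mem_basisCone hd _).1 h
    rw [Finset.sum_eq_single j (fun i _ hi => by rw [h2 i (by simpa using hi), zero_smul])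
      (by simp)] at h3
    simp only [toReal_dotProduct] at h1 h3
    refine ⟨(d j ⬝ᵥ m).toNat, ?_⟩
    have hnn : 0 ≤ d j ⬝ᵥ m := by exact_mod_cast h1 j
    apply toReal_injective
    rw [h3]
    ext i
    simp only [toReal, Pi.smul_apply, smul_eq_mul, nsmul_eq_mul]
    push_cast
    have : ((d j ⬝ᵥ m).toNat : ℝ) = ((d j ⬝ᵥ m : ℤ) : ℝ) := by
      exact_mod_cast congrArg (fun z : ℤ => (z : ℝ)) (Int.toNat_of_nonneg hnn)
    simp [this]
  · rintro ⟨k, rfl⟩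
    have : toReal (k • b j) = (k : NNReal) • toReal (b j) := by
      ext i; simp [toReal, NNReal.smul_def]
    rw [this]
    exact Submodule.smul_mem _ _ (mem_basisCone_of_mem rfl)

end BasisCone

theorem ray_eq_basisCone {ρ : PointedCone ℝ (Fin n → ℝ)}
    {b : Module.Basis (Fin n) ℤ (Fin n → ℤ)} {I : Set (Fin n)} (h : ρ = basisCone b I)
    (h1 : Module.finrank ℝ (Submodule.span ℝ (ρ : Set (Fin n → ℝ))) = 1) :
    ∃ j ∈ I, ρ = basisCone b {j} := by
  rw [h, finrank_basisCone, Set.ncard_eq_one] at h1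
  obtain ⟨j, rfl⟩ := h1
  exact ⟨j, rfl, h⟩

theorem Fan.IsSmooth.exists_primitive {Δ : Fan n} (hΔ : Δ.IsSmooth) (ρ : Δ.Ray) :
    ∃ e, IsPrimitiveGenerator ρ.1 e := by
  obtain ⟨b, I, h⟩ := hΔ ρ.1 ρ.2.1
  obtain ⟨j, -, hj⟩ := ray_eq_basisCone h ρ.2.2
  exact ⟨b j, hj ▸ isPrimitiveGenerator_basisCone j⟩

/-- The primitive generator `e_ρ` of the ray `ρ`. -/
noncomputable def Fan.IsSmooth.gen {Δ : Fan n} (hΔ : Δ.IsSmooth) (ρ : Δ.Ray) : Fin n → ℤ :=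
  (hΔ.exists_primitive ρ).choose

theorem Fan.IsSmooth.gen_spec {Δ : Fan n} (hΔ : Δ.IsSmooth) (ρ : Δ.Ray) :
    IsPrimitiveGenerator ρ.1 (hΔ.gen ρ) := (hΔ.exists_primitive ρ).choose_spec

open Classical in
/-- `m` is a dual frame of the primitive generators of the rays of `σ`. -/
def IsDualFrame {Δ : Fan n} (hΔ : Δ.IsSmooth) (σ : PointedCone ℝ (Fin n → ℝ))
    (m : Δ.Ray → (Fin n → ℤ)) : Prop :=
  ∀ ρ ρ' : Δ.Ray, ρ.1 ≤ σ → ρ'.1 ≤ σ → m ρ ⬝ᵥ hΔ.gen ρ' = if ρ = ρ' then 1 else 0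

theorem Fan.isFaceOf_of_le (Δ : Fan n) {τ σ : PointedCone ℝ (Fin n → ℝ)} (hτ : τ ∈ Δ.cones)
    (hσ : σ ∈ Δ.cones) (h : τ ≤ σ) : τ.IsFaceOf σ := by
  have := (Δ.inter_face τ hτ σ hσ).2
  rwa [inf_eq_left.2 h] at this

theorem Fan.IsSmooth.exists_dualFrame {Δ : Fan n} (hΔ : Δ.IsSmooth)
    {σ : PointedCone ℝ (Fin n → ℝ)} (hσ : σ ∈ Δ.cones) : ∃ m, IsDualFrame hΔ σ m := by
  classical
  obtain ⟨b, I, h⟩ := hΔ σ hσ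
  obtain ⟨d, hd⟩ := exists_dual b
  have key : ∀ ρ : Δ.Ray, ρ.1 ≤ σ → ∃ j, ρ.1 = basisCone b {j} ∧ hΔ.gen ρ = b j := by
    intro ρ hρ
    have hf := Δ.isFaceOf_of_le ρ.2.1 hσ hρ
    rw [h] at hf
    obtain ⟨J, -, hJ⟩ := face_basisCone hf
    obtain ⟨j, -, hj⟩ := ray_eq_basisCone hJ ρ.2.2
    exact ⟨j, hj, (hΔ.gen_spec ρ).unique (hj ▸ isPrimitiveGenerator_basisCone j)⟩
  choose j hj1 hj2 using key
  refine ⟨fun ρ => if hρ : ρ.1 ≤ σ then d (j ρ hρ) else 0, fun ρ ρ' hρ hρ' => ?_⟩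
  simp only [hρ, dif_pos]
  rw [hj2 ρ' hρ', hd]
  have h3 : j ρ hρ = j ρ' hρ' ↔ ρ = ρ' :=
    ⟨fun e => Subtype.ext (by rw [hj1 ρ hρ, hj1 ρ' hρ', e]), fun e => by subst e; rfl⟩
  simp only [h3]

/-- The chosen dual frame `(m_{ρ,σ})_ρ` of `σ`. -/
noncomputable def Fan.IsSmooth.frame {Δ : Fan n} (hΔ : Δ.IsSmooth)
    {σ : PointedCone ℝ (Fin n → ℝ)} (hσ : σ ∈ Δ.cones) : Δ.Ray → (Fin n → ℤ) :=
  (hΔ.exists_dualFrame hσ).choose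

theorem Fan.IsSmooth.frame_spec {Δ : Fan n} (hΔ : Δ.IsSmooth)
    {σ : PointedCone ℝ (Fin n → ℝ)} (hσ : σ ∈ Δ.cones) : IsDualFrame hΔ σ (hΔ.frame hσ) :=
  (hΔ.exists_dualFrame hσ).choose_spec

/-! ## Charts are open and intersect in charts -/

theorem natSmul_dot (k : Fin n → ℤ) (N : ℕ) (v : Fin n → ℤ) : (N • k) ⬝ᵥ v = N * (k ⬝ᵥ v) := by
  rw [smul_dotProduct, nsmul_eq_mul]

/-- Localisation of `S_σ` at a face, and at the intersection of two faces. -/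
theorem exists_sep {σ τ₁ τ₂ : PointedCone ℝ (Fin n → ℝ)} (hσ : IsSmoothCone σ)
    (h₁ : τ₁.IsFaceOf σ) (h₂ : τ₂.IsFaceOf σ) :
    ∃ k₁ k₂ : Fin n → ℤ, k₁ ∈ dualMonoid σ ∧ k₂ ∈ dualMonoid σ ∧ -k₁ ∈ dualMonoid τ₁ ∧
      -k₂ ∈ dualMonoid τ₂ ∧
      ∀ u ∈ dualMonoid (τ₁ ⊓ τ₂), ∃ N : ℕ, u + N • (k₁ + k₂) ∈ dualMonoid σ := by
  classical
  obtain ⟨b, I, rfl⟩ := hσ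
  obtain ⟨d, hd⟩ := exists_dual b
  obtain ⟨J₁, hJ₁, rfl⟩ := face_basisCone h₁
  obtain ⟨J₂, hJ₂, rfl⟩ := face_basisCone h₂
  have hk : ∀ (J : Set (Fin n)) (j : Fin n),
      (∑ i, if i ∈ J then 0 else d i) ⬝ᵥ b j = if j ∈ J then 0 else 1 := by
    intro J j
    rw [sum_dotProduct, Finset.sum_eq_single j]
    · split_ifs <;> simp [hd]
    · intro i _ hij
      split_ifs <;> simp [hd, hij]
    · simp
  refine ⟨∑ i, if i ∈ J₁ then 0 else d i, ∑ i, if i ∈ J₂ then 0 else d i, ?_, ?_, ?_, ?_, ?_⟩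
  · refine (mem_dualMonoid_basisCone _).2 fun i _ => ?_
    rw [hk]; split_ifs <;> simp
  · refine (mem_dualMonoid_basisCone _).2 fun i _ => ?_
    rw [hk]; split_ifs <;> simp
  · refine (mem_dualMonoid_basisCone _).2 fun i hi => ?_
    rw [neg_dotProduct, hk, if_pos hi, neg_zero]
  · refine (mem_dualMonoid_basisCone _).2 fun i hi => ?_
    rw [neg_dotProduct, hk, if_pos hi, neg_zero]
  · intro u hu
    refine ⟨∑ i, (u ⬝ᵥ b i).natAbs, (mem_dualMonoid_basisCone _).2 fun i hi => ?_⟩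
    rw [add_dotProduct, natSmul_dot, add_dotProduct, hk, hk]
    by_cases hm : i ∈ J₁ ∧ i ∈ J₂
    · rw [if_pos hm.1, if_pos hm.2]
      have := hu _ ⟨mem_basisCone_of_mem hm.1, mem_basisCone_of_mem hm.2⟩
      rw [toReal_dotProduct] at this
      have h' : 0 ≤ u ⬝ᵥ b i := by exact_mod_cast this
      simpa using h'
    · have h1 : (u ⬝ᵥ b i).natAbs ≤ ∑ i, (u ⬝ᵥ b i).natAbs :=
        Finset.single_le_sum (f := fun i => (u ⬝ᵥ b i).natAbs) (fun _ _ => Nat.zero_le _)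
          (Finset.mem_univ i)
      have h2 : (1 : ℤ) ≤ (if i ∈ J₁ then 0 else 1) + (if i ∈ J₂ then 0 else 1) := by
        split_ifs with h3 h4 <;> simp_all
      have h3 : (0 : ℤ) ≤ ((∑ i, (u ⬝ᵥ b i).natAbs : ℕ) : ℤ) := Int.natCast_nonneg _
      have h4 : -(u ⬝ᵥ b i) ≤ ((u ⬝ᵥ b i).natAbs : ℤ) := by omega
      have h5 : (((u ⬝ᵥ b i).natAbs : ℕ) : ℤ) ≤ ((∑ i, (u ⬝ᵥ b i).natAbs : ℕ) : ℤ) := by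
        exact_mod_cast h1
      nlinarith

theorem exists_sep' {σ τ : PointedCone ℝ (Fin n → ℝ)} (hσ : IsSmoothCone σ)
    (h : τ.IsFaceOf σ) :
    ∃ k : Fin n → ℤ, k ∈ dualMonoid σ ∧ -k ∈ dualMonoid τ ∧
      ∀ u ∈ dualMonoid τ, ∃ N : ℕ, u + N • k ∈ dualMonoid σ := by
  obtain ⟨k₁, k₂, h1, h2, h3, h4, h5⟩ := exists_sep hσ h h
  refine ⟨k₁ + k₂, add_mem h1 h2, ?_, fun u hu => h5 u (by rwa [inf_idem])⟩
  rw [neg_add]; exact add_mem h3 h4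

theorem AffineToric.ne_bot {σ : PointedCone ℝ (Fin n → ℝ)} (x : AffineToric σ)
    {m : Fin n → ℤ} (h : m ∈ dualMonoid σ) (h' : -m ∈ dualMonoid σ) : x ⟨m, h⟩ ≠ ⊥ := by
  intro e
  have h1 : x (⟨m, h⟩ + ⟨-m, h'⟩) = 0 := by
    rw [← map_zero x]; congr 1; ext; simp
  rw [map_add, e, WithBot.bot_add] at h1
  exact WithBot.bot_ne_zero h1

theorem trop_cancel {a b c : TropNum} (hc : c ≠ ⊥) (h : a + c = b + c) : a = b := by
  exact WithBot.add_right_cancel hc h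

theorem nsmul_ne_bot {a : TropNum} (ha : a ≠ ⊥) (N : ℕ) : N • a ≠ ⊥ := by
  lift a to ℝ using ha
  rw [← WithBot.coe_nsmul]
  exact WithBot.coe_ne_bot

/-- A homomorphism on `S_σ` extends to `S_τ` if it is finite at `k`, where `S_τ = S_σ - ℕ k`. -/
theorem AffineToric.exists_extension {σ τ : PointedCone ℝ (Fin n → ℝ)} (hτ : τ ≤ σ)
    {k : Fin n → ℤ} (hk : k ∈ dualMonoid σ)
    (hu : ∀ u ∈ dualMonoid τ, ∃ N : ℕ, u + N • k ∈ dualMonoid σ) (y : AffineToric σ)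
    (hy : y ⟨k, hk⟩ ≠ ⊥) : ∃ w : AffineToric τ, AffineToric.incl hτ w = y := by
  obtain ⟨r, hr⟩ := WithBot.ne_bot_iff_exists.1 hy
  have hyk : ∀ (u : Fin n → ℤ) (hu : u ∈ dualMonoid σ) (N : ℕ) (h : u + N • k ∈ dualMonoid σ),
      y ⟨u + N • k, h⟩ = y ⟨u, hu⟩ + N • y ⟨k, hk⟩ := by
    intro u hu N h
    rw [← map_nsmul, ← map_add]; rfl
  let R : (Fin n → ℤ) → TropNum → Prop := fun u t =>
    ∃ (N : ℕ) (h : u + N • k ∈ dualMonoid σ), y ⟨u + N • k, h⟩ = t + N • y ⟨k, hk⟩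
  have hex : ∀ u : dualMonoid τ, ∃ t, R u.1 t := by
    intro u
    obtain ⟨N, hN⟩ := hu u.1 u.2
    refine ⟨y ⟨_, hN⟩ + ((-(N • r) : ℝ) : WithBot ℝ), N, hN, ?_⟩
    rw [← hr, ← WithBot.coe_nsmul, add_assoc, ← WithBot.coe_add, neg_add_cancel, WithBot.coe_zero,
      add_zero]
  have huniq : ∀ u t t', R u t → R u t' → t = t' := by
    rintro u t t' ⟨N, h, e⟩ ⟨N', h', e'⟩
    have h2 : u + N • k + N' • k ∈ dualMonoid σ := add_mem h (nsmul_mem hk _)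
    have h3 : u + N' • k + N • k ∈ dualMonoid σ := add_mem h' (nsmul_mem hk _)
    have h4 := hyk _ h N' h2
    have h5 := hyk _ h' N h3
    have h6 : (⟨u + N • k + N' • k, h2⟩ : dualMonoid σ) = ⟨u + N' • k + N • k, h3⟩ :=
      Subtype.ext (by simp only; abel)
    rw [h6, h5, e, e', add_assoc, add_assoc, add_comm (N • _)] at h4
    refine (trop_cancel ?_ h4).symm
    rw [← add_smul]
    exact nsmul_ne_bot hy _
  choose w hw using hex
  refine ⟨⟨⟨w, ?_⟩, ?_⟩, ?_⟩
  · refine huniq _ _ _ (hw 0) ⟨0, ?_, ?_⟩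
    · simp
    · simp only [zero_smul, add_zero]
      exact map_zero y
  · intro u v
    refine huniq _ _ _ (hw (u + v)) ?_
    obtain ⟨N, h, e⟩ := hw u
    obtain ⟨N', h', e'⟩ := hw v
    have h6 : u.1 + N • k + (v.1 + N' • k) = (u + v : dualMonoid τ).1 + (N + N') • k := by
      rw [add_smul]; push_cast; abel
    refine ⟨N + N', h6 ▸ add_mem h h', ?_⟩
    have h7 : (⟨(u + v : dualMonoid τ).1 + (N + N') • k, h6 ▸ add_mem h h'⟩ : dualMonoid σ) =
      ⟨_, h⟩ + ⟨_, h'⟩ := Subtype.ext h6.symm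
    rw [h7, map_add, e, e', add_smul]
    abel
  · refine AddMonoidHom.ext fun u => ?_
    have h0 : u.1 + 0 • k = u.1 := by rw [zero_smul, add_zero]
    have h1 : R u.1 (y u) := ⟨0, h0.symm ▸ u.2, by
      exact (congrArg y (Subtype.ext h0)).trans (by simp only [zero_smul, add_zero])⟩
    exact huniq u.1 _ _ (hw ⟨u.1, dualMonoid_anti hτ u.2⟩) h1

theorem AffineToric.incl_injective {σ τ : PointedCone ℝ (Fin n → ℝ)} (hσ : IsSmoothCone σ)
    (h : τ.IsFaceOf σ) : Function.Injective (AffineToric.incl h.le) := by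
  intro w w' e
  obtain ⟨k, hk, hk', hu⟩ := exists_sep' hσ h
  have hkτ := dualMonoid_anti h.le hk
  refine AddMonoidHom.ext fun u => ?_
  obtain ⟨N, hN⟩ := hu u.1 u.2
  have h1 : ∀ (m : Fin n → ℤ) (hm : m ∈ dualMonoid σ),
      w ⟨m, dualMonoid_anti h.le hm⟩ = w' ⟨m, dualMonoid_anti h.le hm⟩ :=
    fun m hm => DFunLike.congr_fun e ⟨m, hm⟩
  have h2 := h1 _ hN
  have h3 : (⟨u.1 + N • k, dualMonoid_anti h.le hN⟩ : dualMonoid τ) = u + N • ⟨k, hkτ⟩ := rfl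
  rw [h3, map_add, map_add, map_nsmul, map_nsmul, h1 k hk] at h2
  exact trop_cancel (nsmul_ne_bot (w'.ne_bot hkτ hk') N) h2

theorem AffineToric.exists_inf {σ τ₁ τ₂ : PointedCone ℝ (Fin n → ℝ)} (hσ : IsSmoothCone σ)
    (h₁ : τ₁.IsFaceOf σ) (h₂ : τ₂.IsFaceOf σ) (z₁ : AffineToric τ₁) (z₂ : AffineToric τ₂)
    (h : AffineToric.incl h₁.le z₁ = AffineToric.incl h₂.le z₂) :
    ∃ w : AffineToric (τ₁ ⊓ τ₂), AffineToric.incl inf_le_left w = z₁ ∧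
      AffineToric.incl inf_le_right w = z₂ := by
  obtain ⟨k₁, k₂, hk₁, hk₂, hk₁', hk₂', hu⟩ := exists_sep hσ h₁ h₂
  have e : AffineToric.incl h₁.le z₁ ⟨k₁ + k₂, add_mem hk₁ hk₂⟩ ≠ ⊥ := by
    have e1 : AffineToric.incl h₁.le z₁ ⟨k₁, hk₁⟩ ≠ ⊥ :=
      z₁.ne_bot (dualMonoid_anti h₁.le hk₁) hk₁'
    have e2 : AffineToric.incl h₁.le z₁ ⟨k₂, hk₂⟩ ≠ ⊥ := by
      rw [h]; exact z₂.ne_bot (dualMonoid_anti h₂.le hk₂) hk₂'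
    have e3 : (⟨k₁ + k₂, add_mem hk₁ hk₂⟩ : dualMonoid σ) = ⟨k₁, hk₁⟩ + ⟨k₂, hk₂⟩ := rfl
    rw [e3, map_add]
    exact WithBot.add_ne_bot.2 ⟨e1, e2⟩
  obtain ⟨w, hw⟩ := AffineToric.exists_extension (inf_le_left.trans h₁.le) (add_mem hk₁ hk₂) hu _ e
  exact ⟨w, AffineToric.incl_injective hσ h₁ hw, AffineToric.incl_injective hσ h₂ (hw.trans h)⟩

theorem Fan.chart_incl (Δ : Fan n) {σ τ : PointedCone ℝ (Fin n → ℝ)} (hσ : σ ∈ Δ.cones)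
    (hτ : τ ∈ Δ.cones) (h : τ ≤ σ) (z : AffineToric τ) :
    Δ.chart hσ (AffineToric.incl h z) = Δ.chart hτ z :=
  Quot.sound ⟨τ, hτ, h, le_rfl, z, rfl, rfl⟩

/-- A point `x` of `U_σ'` lies in `U_σ` if and only if it lies in `U_{σ ∩ σ'}`. -/
theorem Fan.IsSmooth.chart_mem_chartSet {Δ : Fan n} (hΔ : Δ.IsSmooth)
    {σ σ' : PointedCone ℝ (Fin n → ℝ)} (hσ : σ ∈ Δ.cones) (hσ' : σ' ∈ Δ.cones)
    (x : AffineToric σ') :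
    Δ.chart hσ' x ∈ Δ.chartSet hσ ↔
      ∃ z : AffineToric (σ ⊓ σ'), AffineToric.incl inf_le_right z = x := by
  constructor
  · rintro ⟨y, hy⟩
    let Q : Δ.Pieces → Prop := fun a =>
      ∃ z : AffineToric (σ ⊓ a.1.1), AffineToric.incl inf_le_right z = a.2
    have hQ : ∀ a c : Δ.Pieces, Δ.glue a c → Q a → Q c := by
      rintro ⟨⟨α, hα⟩, xa⟩ ⟨⟨γ, hγ⟩, xc⟩ ⟨τ, hτ, ha, hc, z, hz, hz'⟩ ⟨w, hw⟩
      dsimp only at ha hc z hz hz' w hw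
      obtain ⟨v, hv1, hv2⟩ := AffineToric.exists_inf (hΔ α hα) (Δ.isFaceOf_of_le hτ hα ha)
        (Δ.inter_face σ hσ α hα).2 z w (hz.trans hw.symm)
      refine ⟨AffineToric.incl (le_inf (inf_le_right.trans inf_le_left)
        (inf_le_left.trans hc)) v, ?_⟩
      rw [← hz', ← hv1]
      rfl
    have hsymm : ∀ a c : Δ.Pieces, Δ.glue a c → Δ.glue c a := by
      rintro a c ⟨τ, hτ, ha, hc, z, hz, hz'⟩
      exact ⟨τ, hτ, hc, ha, z, hz', hz⟩
    have hiff : ∀ a c : Δ.Pieces, Δ.glue a c → Q a = Q c := fun a c h =>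
      propext ⟨hQ a c h, hQ c a (hsymm a c h)⟩
    have h1 : Quot.lift Q hiff (Δ.chart hσ y) = Quot.lift Q hiff (Δ.chart hσ' x) := by rw [hy]
    have h2 : Q ⟨⟨σ, hσ⟩, y⟩ :=
      ⟨AffineToric.incl (le_inf le_rfl le_rfl) y, rfl⟩
    have h3 : Q ⟨⟨σ, hσ⟩, y⟩ = Q ⟨⟨σ', hσ'⟩, x⟩ := h1
    exact h3.mp h2
  · rintro ⟨z, rfl⟩
    rw [Δ.chart_incl hσ' (Δ.inf_mem hσ hσ') inf_le_right, ← Δ.chart_incl hσ _ inf_le_left]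
    exact ⟨_, rfl⟩

theorem Fan.IsSmooth.chartSet_inter {Δ : Fan n} (hΔ : Δ.IsSmooth)
    {σ σ' : PointedCone ℝ (Fin n → ℝ)} (hσ : σ ∈ Δ.cones) (hσ' : σ' ∈ Δ.cones) :
    Δ.chartSet hσ ∩ Δ.chartSet hσ' = Δ.chartSet (Δ.inf_mem hσ hσ') := by
  ext p
  constructor
  · rintro ⟨h, x, rfl⟩
    obtain ⟨z, rfl⟩ := (hΔ.chart_mem_chartSet hσ hσ' x).1 h
    exact ⟨z, (Δ.chart_incl hσ' _ inf_le_right z).symm⟩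
  · rintro ⟨z, rfl⟩
    exact ⟨⟨_, Δ.chart_incl hσ _ inf_le_left z⟩, ⟨_, Δ.chart_incl hσ' _ inf_le_right z⟩⟩

theorem AffineToric.continuous_eval {σ : PointedCone ℝ (Fin n → ℝ)} (m : dualMonoid σ) :
    Continuous fun x : AffineToric σ => x m :=
  (continuous_apply m).comp continuous_induced_dom

theorem Fan.IsSmooth.isOpen_chartSet {Δ : Fan n} (hΔ : Δ.IsSmooth)
    {σ : PointedCone ℝ (Fin n → ℝ)} (hσ : σ ∈ Δ.cones) : IsOpen (Δ.chartSet hσ) := by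
  have h : IsOpen (Quot.mk Δ.glue ⁻¹' (Δ.chartSet hσ : Set (Quot Δ.glue))) := by
    rw [isOpen_sigma_iff]
    rintro ⟨σ', hσ'⟩
    obtain ⟨k, hk, hk', hu⟩ := exists_sep' (hΔ σ' hσ') (Δ.inter_face σ hσ σ' hσ').2
    have e : (Sigma.mk (⟨σ', hσ'⟩ : {σ // σ ∈ Δ.cones}) ⁻¹'
        (Quot.mk Δ.glue ⁻¹' (Δ.chartSet hσ : Set (Quot Δ.glue)))) =
        (fun x : AffineToric σ' => x ⟨k, hk⟩) ⁻¹' {⊥}ᶜ := by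
      ext x
      refine (hΔ.chart_mem_chartSet hσ hσ' x).trans ⟨?_, ?_⟩
      · rintro ⟨z, rfl⟩
        exact z.ne_bot (dualMonoid_anti inf_le_right hk) hk'
      · exact fun hx => AffineToric.exists_extension inf_le_right hk hu x hx
    rw [e]
    exact isOpen_compl_singleton.preimage (AffineToric.continuous_eval _)
  exact h

theorem Fan.exists_mem_chartSet (Δ : Fan n) (p : Δ.Variety) :
    ∃ (σ : PointedCone ℝ (Fin n → ℝ)) (hσ : σ ∈ Δ.cones), p ∈ Δ.chartSet hσ := by
  induction p using Quot.ind with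
  | mk a => exact ⟨a.1.1, a.1.2, a.2, rfl⟩

/-! ## Toric divisors -/

open Classical in
/-- The element `∑ a_ρ m_{ρ,σ}` of `M`, the sum over all rays `ρ ≺ σ`. -/
noncomputable def Fan.IsSmooth.localExponent {Δ : Fan n} (hΔ : Δ.IsSmooth) (a : Δ.Ray → ℤ)
    {σ : PointedCone ℝ (Fin n → ℝ)} (hσ : σ ∈ Δ.cones) : Fin n → ℤ :=
  ∑ ρ : Δ.Ray, if ρ.1 ≤ σ then a ρ • hΔ.frame hσ ρ else 0

theorem Fan.IsSmooth.localExponent_gen {Δ : Fan n} (hΔ : Δ.IsSmooth) (a : Δ.Ray → ℤ)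
    {σ : PointedCone ℝ (Fin n → ℝ)} (hσ : σ ∈ Δ.cones) (ρ : Δ.Ray) (hρ : ρ.1 ≤ σ) :
    hΔ.localExponent a hσ ⬝ᵥ hΔ.gen ρ = a ρ := by
  classical
  rw [localExponent, sum_dotProduct, Finset.sum_eq_single ρ]
  · rw [if_pos hρ, smul_dotProduct, hΔ.frame_spec hσ ρ ρ hρ hρ, if_pos rfl]; simp
  · intro ρ' _ hne
    split_ifs with h
    · rw [smul_dotProduct, hΔ.frame_spec hσ ρ' ρ h hρ, if_neg hne, smul_zero]
    · simp
  · simp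

/-- A lattice point of `M` is in `S_σ` as soon as it is nonnegative on the rays of `σ`. -/
theorem Fan.IsSmooth.mem_dualMonoid {Δ : Fan n} (hΔ : Δ.IsSmooth)
    {σ : PointedCone ℝ (Fin n → ℝ)} (hσ : σ ∈ Δ.cones) (m : Fin n → ℤ)
    (h : ∀ ρ : Δ.Ray, ρ.1 ≤ σ → 0 ≤ m ⬝ᵥ hΔ.gen ρ) : m ∈ dualMonoid σ := by
  obtain ⟨b, I, e⟩ := hΔ σ hσ
  subst e
  refine (mem_dualMonoid_basisCone m).2 fun i hi => ?_
  have hf : (basisCone b {i}).IsFaceOf (basisCone b I) :=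
    isFaceOf_basisCone (Set.singleton_subset_iff.2 hi)
  let ρ : Δ.Ray := ⟨basisCone b {i}, Δ.face_mem _ hσ _ hf, by
    rw [finrank_basisCone, Set.ncard_singleton]⟩
  have h1 := h ρ hf.le
  rwa [(hΔ.gen_spec ρ).unique (isPrimitiveGenerator_basisCone i)] at h1

/-- The tropical monomial `c + x(m)`. -/
def TropPoly.monomial {σ : PointedCone ℝ (Fin n → ℝ)} (m : dualMonoid σ) (c : ℝ) : TropPoly σ :=
  ⟨{m}, Finset.singleton_nonempty m, fun _ => c⟩

theorem TropPoly.eval_monomial {σ : PointedCone ℝ (Fin n → ℝ)} (m : dualMonoid σ) (c : ℝ)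
    (y : Fin n → ℝ) : (TropPoly.monomial m c).eval y = c + toReal m.1 ⬝ᵥ y := by
  simp [TropPoly.eval, TropPoly.monomial]

theorem Fan.IsSmooth.isRegularAt_monomial {Δ : Fan n} (hΔ : Δ.IsSmooth)
    {σ : PointedCone ℝ (Fin n → ℝ)} (hσ : σ ∈ Δ.cones) {p : Δ.Variety} (hp : p ∈ Δ.chartSet hσ)
    {m : Fin n → ℤ} (hm : m ∈ dualMonoid σ) : IsRegularAt Δ (fun y => toReal m ⬝ᵥ y) p := by
  refine ⟨σ, hσ, Δ.chartSet hσ, hΔ.isOpen_chartSet hσ, hp, subset_rfl,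
    TropPoly.monomial ⟨m, hm⟩ 0, 0, 0, fun x _ => ?_, fun y _ => ?_⟩
  · rw [map_zero]; exact WithBot.zero_ne_bot
  · have h : toReal (0 : Fin n → ℤ) = 0 := by ext i; simp [toReal]
    simp [TropPoly.eval_monomial, h]

theorem Fan.IsSmooth.isRationalAt_monomial {Δ : Fan n} (hΔ : Δ.IsSmooth)
    {σ : PointedCone ℝ (Fin n → ℝ)} (hσ : σ ∈ Δ.cones) {p : Δ.Variety} (hp : p ∈ Δ.chartSet hσ)
    (m : Fin n → ℤ) : IsRationalAt Δ (fun y => toReal m ⬝ᵥ y) p := by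
  obtain ⟨b, I, e⟩ := hΔ σ hσ
  subst e
  have hbot : (basisCone b ∅).IsFaceOf (basisCone b I) := isFaceOf_basisCone (Set.empty_subset I)
  obtain ⟨k, hk, -, hu⟩ := exists_sep' (hΔ _ hσ) hbot
  obtain ⟨N, hN⟩ := hu m ((mem_dualMonoid_basisCone m).2 fun i hi => hi.elim)
  refine ⟨_, hσ, Δ.chartSet hσ, hΔ.isOpen_chartSet hσ, hp, subset_rfl,
    TropPoly.monomial ⟨_, hN⟩ 0, TropPoly.monomial ⟨N • k, nsmul_mem hk N⟩ 0, fun y _ => ?_⟩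
  simp [TropPoly.eval_monomial, toReal_add, add_dotProduct]

/-- The toric divisor `∑ a_ρ D_ρ`. On `U_σ` the ray divisor `D_ρ` is given by the function
`φ_{ρ,σ}(x) = x(m_{ρ,σ})` if `ρ ≺ σ` and by `0` otherwise; so `∑ a_ρ D_ρ` is represented by the pairs
`(U_σ, ∑_{ρ ≺ σ} a_ρ φ_{ρ,σ})`. -/
noncomputable def Fan.IsSmooth.toricDivisor {Δ : Fan n} (hΔ : Δ.IsSmooth) (a : Δ.Ray → ℤ) :
    CartierDivisor Δ where
  pairs := {P | ∃ (σ : PointedCone ℝ (Fin n → ℝ)) (hσ : σ ∈ Δ.cones),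
    P = (Δ.chartSet hσ, fun y => toReal (hΔ.localExponent a hσ) ⬝ᵥ y)}
  isOpen := by
    rintro _ ⟨σ, hσ, rfl⟩
    exact hΔ.isOpen_chartSet hσ
  cover := fun p => by
    obtain ⟨σ, hσ, hp⟩ := Δ.exists_mem_chartSet p
    exact ⟨_, ⟨σ, hσ, rfl⟩, hp⟩
  rational := by
    rintro _ ⟨σ, hσ, rfl⟩ p hp
    exact hΔ.isRationalAt_monomial hσ hp _
  compat := by
    rintro _ ⟨σ, hσ, rfl⟩ _ ⟨σ', hσ', rfl⟩ p hp
    rw [hΔ.chartSet_inter hσ hσ'] at hp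
    have key : ∀ ρ : Δ.Ray, ρ.1 ≤ σ ⊓ σ' →
        (hΔ.localExponent a hσ - hΔ.localExponent a hσ') ⬝ᵥ hΔ.gen ρ = 0 := fun ρ hρ => by
      rw [sub_dotProduct, hΔ.localExponent_gen a hσ ρ (hρ.trans inf_le_left),
        hΔ.localExponent_gen a hσ' ρ (hρ.trans inf_le_right), sub_self]
    have e : ((fun y => toReal (hΔ.localExponent a hσ) ⬝ᵥ y) -
        (fun y => toReal (hΔ.localExponent a hσ') ⬝ᵥ y) : (Fin n → ℝ) → ℝ) =
        fun y => toReal (hΔ.localExponent a hσ - hΔ.localExponent a hσ') ⬝ᵥ y := by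
      funext y; simp [toReal_sub, sub_dotProduct]
    have e' : -(fun y => toReal (hΔ.localExponent a hσ - hΔ.localExponent a hσ') ⬝ᵥ y) =
        fun y => toReal (-(hΔ.localExponent a hσ - hΔ.localExponent a hσ')) ⬝ᵥ y := by
      funext y; simp only [Pi.neg_apply, toReal_neg, neg_dotProduct]
    constructor
    · rw [e]
      exact hΔ.isRegularAt_monomial _ hp
        (hΔ.mem_dualMonoid (Δ.inf_mem hσ hσ') _ fun ρ hρ => (key ρ hρ).ge)
    · rw [e, e']
      refine hΔ.isRegularAt_monomial _ hp
        (hΔ.mem_dualMonoid (Δ.inf_mem hσ hσ') _ fun ρ hρ => ?_)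
      rw [neg_dotProduct, key ρ hρ, neg_zero]

/-- The polyhedron `P_D = {m ∈ M_ℝ | ⟨m, e_ρ⟩ + a_ρ ≥ 0 for all rays ρ}` of `D = ∑ a_ρ D_ρ`. -/
def Fan.IsSmooth.polyhedron {Δ : Fan n} (hΔ : Δ.IsSmooth) (a : Δ.Ray → ℤ) : Set (Fin n → ℝ) :=
  {m | ∀ ρ : Δ.Ray, 0 ≤ m ⬝ᵥ toReal (hΔ.gen ρ) + a ρ}

end TropToric

open Filter Topology

/-! A member of `|D|` has the form `D + div h`. On `N_ℝ`, effectivity makes `h` locally a maximum of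
integral affine functions. Local convexity on a real vector space is global
(`subgradient_of_local`), so every local slope `m` of `h` gives a global affine minorant. Going to
infinity along `-e_ρ`, one approaches a point of the chart `U_ρ`, near which `h` plus the local
equation of `D` stays bounded above. Comparison with the minorant forces `⟨m, e_ρ⟩ + a_ρ ≥ 0`. Hence
all slopes of `h` are lattice points of `P_D` (`exists_convex_of_mem_linearSystem`).

Upper bound (`exists_not_passes`): if `P_D` has `k` lattice points, put `k` inner points on a line
whose direction `v` separates the lattice. A divisor passing an inner point makes `h` have two
slopes there. Slopes increase along the line by convexity, so passing all `k` points would require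
`k + 1` different lattice points.

Lower bound (`exists_passes`): given `k` points and `k + 1` lattice points of `P_D`, the values of
the monomials at the points form a tropical `k × (k + 1)` matrix. A tropical kernel vector
(`exists_tropical_kernel`), found by lifting to Hahn series, supplies coefficients such that at each
point the maximum is `-∞` or attained twice. At such a point the local function is not invertible
(`not_isRegularAt_neg`): attained twice, it is strictly convex in some direction, which contradicts
the convexity of its negative. At value `-∞` its negative would be unbounded above.

Boundary points are treated throughout as limits of inner points `y - t w`, with `y` allowed to vary
(`IsLimitAlong`, `IsTropicalAlong`). This reduces local questions on the variety to maxima of affine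
functions on `N_ℝ`. -/

/-! ### Tropical linear algebra. -/

/-- A tropical matrix with more columns than rows has a nontrivial kernel vector `c`: no row of
`A + c` has a finite entry that exceeds all its other entries. -/
theorem exists_tropical_kernel {ι κ : Type*} [Fintype ι] [Fintype κ]
    (hcard : Fintype.card ι < Fintype.card κ) (A : ι → κ → WithBot ℝ) :
    ∃ c : κ → WithBot ℝ, (∃ i, c i ≠ ⊥) ∧
      ∀ j i₀, A j i₀ + c i₀ ≠ ⊥ → ∃ i, i ≠ i₀ ∧ A j i₀ + c i₀ ≤ A j i + c i := by
  classical
  -- Lift to a valued field: an entry `r` becomes the monomial of exponent `-r`, and `⊥` becomes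
  -- `0`. The sign turns the max convention into the min convention of valuations. Ordinary linear
  -- algebra gives a kernel vector `v`, and `c` records minus its orders.
  let K := HahnSeries ℝ ℚ
  let ν := HahnSeries.addVal ℝ ℚ
  let lift : WithBot ℝ → K := WithBot.recBotCoe 0 fun r => HahnSeries.single (-r) 1
  let B : Matrix ι κ K := fun j i => lift (A j i)
  obtain ⟨v, hv, hv0⟩ := Submodule.ne_bot_iff _ |>.1
    (LinearMap.ker_ne_bot_of_finrank_lt (f := B.mulVecLin) (by simpa using hcard))
  let c : κ → WithBot ℝ := fun i => if v i = 0 then ⊥ else ((-(v i).order : ℝ) : WithBot ℝ)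
  have hcoe : ∀ j i (r : ℝ), A j i + c i = r → ν (B j i * v i) = ((-r : ℝ) : WithTop ℝ) := by
    intro j i r h
    have hvi : v i ≠ 0 := by
      intro h0
      simp [c, h0] at h
    obtain ⟨a, ha⟩ := WithBot.ne_bot_iff_exists.1 (show A j i ≠ ⊥ by
      intro h0
      simp [h0] at h)
    have h1 : a + -(v i).order = r := by
      rw [← ha] at h
      simp only [c, if_neg hvi] at h
      exact_mod_cast h
    have h2 : B j i = HahnSeries.single (-a) 1 := by simp [B, lift, ← ha]
    rw [AddValuation.map_mul, h2, HahnSeries.addVal_apply, HahnSeries.addVal_apply_of_ne hvi,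
      HahnSeries.orderTop_single one_ne_zero, ← WithTop.coe_add]
    congr 1
    linarith
  have hbot : ∀ j i, A j i + c i = ⊥ → B j i * v i = 0 := by
    intro j i h
    rcases WithBot.add_eq_bot.1 h with h | h
    · simp [B, lift, h]
    · have : v i = 0 := by
        by_contra h0
        simp [c, h0] at h
      simp [this]
  refine ⟨c, ?_, fun j i₀ h => ?_⟩
  · obtain ⟨i, hi⟩ := Function.ne_iff.1 hv0
    exact ⟨i, by simpa [c] using hi⟩
  · by_contra! hlt
    obtain ⟨r, hr⟩ := WithBot.ne_bot_iff_exists.1 h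
    have hsum : ∑ i, B j i * v i = 0 := by
      have := congrFun (LinearMap.mem_ker.1 hv) j
      simpa [Matrix.mulVec, dotProduct] using this
    -- A strictly dominant entry would be the unique summand of least valuation in a vanishing sum;
    -- it would equal minus the rest, whose valuation is larger.
    rw [← Finset.add_sum_erase _ _ (Finset.mem_univ i₀), add_eq_zero_iff_eq_neg] at hsum
    have h1 := congrArg ν hsum
    rw [hcoe j i₀ r hr.symm, AddValuation.map_neg] at h1
    refine absurd h1 (ne_of_lt (AddValuation.map_lt_sum _ WithTop.coe_ne_top fun i hi => ?_))
    have h2 := hlt i (Finset.ne_of_mem_erase hi)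
    rw [← hr] at h2
    by_cases h3 : A j i + c i = ⊥
    · rw [hbot j i h3, AddValuation.map_zero]
      exact WithTop.coe_lt_top _
    · obtain ⟨q, hq⟩ := WithBot.ne_bot_iff_exists.1 h3
      rw [hcoe j i q hq.symm, WithTop.coe_lt_coe]
      rw [← hq, WithBot.coe_lt_coe] at h2
      linarith

/-! ### From local to global convexity. -/

/-- A continuous function of one variable that has a local affine minorant at each point and is
nonnegative near its zero `0` is nonnegative at `1`. -/
theorem nonneg_of_local_support {g : ℝ → ℝ} (hg : Continuous g)
    (hs : ∀ t, ∃ s, ∀ᶠ t' in 𝓝 t, g t + s * (t' - t) ≤ g t') (h0 : g 0 = 0)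
    (hn : ∀ᶠ t in 𝓝 0, 0 ≤ g t) : 0 ≤ g 1 := by
  by_contra! hneg
  -- Subtracting the chord gives `G 0 = G 1 = 0`, and `G` is positive just to the right of `0`
  -- because `g 1 < 0`.
  let G : ℝ → ℝ := fun t => g t - t * g 1
  have hG : Continuous G := by fun_prop
  obtain ⟨t₀, ht₀, hmax⟩ := isCompact_Icc.exists_isMaxOn (Set.nonempty_Icc.2 zero_le_one)
    (hG.continuousOn (s := Set.Icc (0 : ℝ) 1))
  have hcomp : IsCompact (Set.Icc (0 : ℝ) 1 ∩ G ⁻¹' {G t₀}) :=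
    isCompact_Icc.inter_right (isClosed_singleton.preimage hG)
  -- Take the rightmost maximiser. Looking left, the local minorant of `G` there must have
  -- nonnegative slope, so `G` stays maximal slightly to the right, which is a contradiction.
  obtain ⟨t₁, ⟨ht₁, hGt₁⟩, hub⟩ := hcomp.exists_isGreatest ⟨t₀, ht₀, rfl⟩
  rw [Set.mem_preimage, Set.mem_singleton_iff] at hGt₁
  have hpos : 0 < G t₁ := by
    obtain ⟨ε, hε, hball⟩ := Metric.eventually_nhds_iff.1 hn
    have hm : min (ε / 2) 1 > 0 := by positivity
    have h1 := hball (y := min (ε / 2) 1) (by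
      rw [Real.dist_eq, sub_zero, abs_of_pos hm]
      exact (min_le_left _ _).trans_lt (by linarith))
    have h2 := hmax (show min (ε / 2) 1 ∈ Set.Icc (0 : ℝ) 1 from ⟨hm.le, min_le_right _ _⟩)
    rw [hGt₁]
    refine lt_of_lt_of_le ?_ h2
    show 0 < g _ - _ * g 1
    nlinarith
  have hne0 : t₁ ≠ 0 := by
    rintro rfl
    simp [G, h0] at hpos
  have hne1 : t₁ ≠ 1 := by
    rintro rfl
    simp [G] at hpos
  have hIoo : t₁ ∈ Set.Ioo (0 : ℝ) 1 :=
    ⟨lt_of_le_of_ne ht₁.1 hne0.symm, lt_of_le_of_ne ht₁.2 hne1⟩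
  obtain ⟨s, hs⟩ := hs t₁
  obtain ⟨ε, hε, hball⟩ := Metric.eventually_nhds_iff.1 (hs.and (Ioo_mem_nhds hIoo.1 hIoo.2))
  have key : ∀ d : ℝ, |d| < ε → t₁ + d ∈ Set.Icc (0 : ℝ) 1 ∧ (s - g 1) * d ≤ G (t₁ + d) - G t₁ ∧
      G (t₁ + d) ≤ G t₁ := by
    intro d hd
    obtain ⟨h1, h2⟩ := hball (y := t₁ + d) (by rwa [Real.dist_eq, add_sub_cancel_left])
    refine ⟨⟨h2.1.le, h2.2.le⟩, ?_, hGt₁.symm ▸ hmax ⟨h2.1.le, h2.2.le⟩⟩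
    simp only [G]
    linarith
  obtain ⟨h1, h2, h3⟩ := key (ε / 2) (by rw [abs_of_pos (by linarith)]; linarith)
  obtain ⟨-, h5, h6⟩ := key (-(ε / 2)) (by rw [abs_neg, abs_of_pos (by linarith)]; linarith)
  have := hub ⟨h1, show G (t₁ + ε / 2) = G t₀ by rw [← hGt₁]; linarith⟩
  linarith

/-- A continuous function that has a local affine minorant at each point is convex: all its local
subgradients are global. -/
theorem subgradient_of_local {n : ℕ} {f : (Fin n → ℝ) → ℝ} (hf : Continuous f)
    (hs : ∀ x, ∃ m : Fin n → ℝ, ∀ᶠ y in 𝓝 x, f x + m ⬝ᵥ (y - x) ≤ f y) {p m : Fin n → ℝ}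
    (hm : ∀ᶠ y in 𝓝 p, f p + m ⬝ᵥ (y - p) ≤ f y) (y : Fin n → ℝ) :
    f p + m ⬝ᵥ (y - p) ≤ f y := by
  -- Restrict to the segment from `p` to `y` and subtract the candidate minorant: what remains
  -- vanishes at `0` and is nonnegative near `0`.
  let l : ℝ → Fin n → ℝ := fun t => p + t • (y - p)
  have hl : Continuous l := by fun_prop
  have h := nonneg_of_local_support (g := fun t => f (l t) - f p - t * (m ⬝ᵥ (y - p)))
    (by fun_prop) (fun t => ?_) (by simp [l]) ?_
  · simp [l] at h
    rw [dotProduct_sub]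
    linarith
  · obtain ⟨u, hu⟩ := hs (l t)
    refine ⟨u ⬝ᵥ (y - p) - m ⬝ᵥ (y - p), ?_⟩
    filter_upwards [hl.continuousAt.eventually hu] with t' ht'
    have : l t' - l t = (t' - t) • (y - p) := by simp only [l]; module
    rw [this, dotProduct_smul, smul_eq_mul] at ht'
    linarith
  · have h0 : Tendsto l (𝓝 0) (𝓝 p) := by
      have := hl.tendsto 0
      simpa [l] using this
    filter_upwards [h0.eventually hm] with t ht
    have : l t - p = t • (y - p) := by simp only [l]; module
    rw [this, dotProduct_smul, smul_eq_mul] at ht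
    linarith

/-! ### A direction that separates the lattice points. -/

/-- There is a vector on which all nonzero integral linear forms are nonzero. -/
theorem exists_injective_dotProduct (n : ℕ) :
    ∃ v : Fin n → ℝ, Function.Injective fun m : Fin n → ℤ => TropToric.toReal m ⬝ᵥ v := by
  obtain ⟨α, hα⟩ : ∃ α : ℝ, Transcendental ℤ α :=
    ⟨_, transcendental_liouvilleNumber (m := 2) le_rfl⟩
  -- On the powers of a transcendental number, an integral linear form is an integer polynomial
  -- evaluated there, so it vanishes only if its coefficients do.
  refine ⟨fun i => α ^ (i : ℕ), fun a b hab => ?_⟩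
  let P : Polynomial ℤ := ∑ i : Fin n, Polynomial.monomial (i : ℕ) (a i - b i)
  have hP : P = 0 := by
    refine (transcendental_iff.1 hα) P ?_
    simp only [P, map_sum, Polynomial.aeval_monomial]
    simp only [TropToric.toReal, dotProduct] at hab
    simp [sub_mul, Finset.sum_sub_distrib, hab]
  ext i
  have := congrArg (fun Q => Polynomial.coeff Q i) hP
  simp only [P, Polynomial.finsetSum_coeff, Polynomial.coeff_monomial,
    Polynomial.coeff_zero] at this
  rw [Finset.sum_eq_single i (fun j _ hj => if_neg fun h => hj (Fin.ext h)) (by simp)] at this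
  simpa [sub_eq_zero] using this

namespace TropToric

variable {n : ℕ}

/-! ## Points of toric varieties as limits of inner points -/

/-- The point `x` of `U_σ` is the limit of the inner points `y - t w` for `t → ∞`. -/
def IsLimitAlong {σ : PointedCone ℝ (Fin n → ℝ)} (x : AffineToric σ) (y w : Fin n → ℝ) : Prop :=
  ∀ u : dualMonoid σ, 0 ≤ toReal u.1 ⬝ᵥ w ∧
    (toReal u.1 ⬝ᵥ w = 0 → x u = ((toReal u.1 ⬝ᵥ y : ℝ) : WithBot ℝ)) ∧
    (0 < toReal u.1 ⬝ᵥ w → x u = ⊥)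

theorem isLimitAlong_inner (σ : PointedCone ℝ (Fin n → ℝ)) (y : Fin n → ℝ) :
    IsLimitAlong (AffineToric.inner σ y) y 0 := fun u => by
  simp [AffineToric.inner]

theorem IsLimitAlong.incl {τ σ : PointedCone ℝ (Fin n → ℝ)} {z : AffineToric τ}
    {y w : Fin n → ℝ} (h : IsLimitAlong z y w) (hτ : τ ≤ σ) :
    IsLimitAlong (AffineToric.incl hτ z) y w :=
  fun u => h ⟨u.1, dualMonoid_anti hτ u.2⟩

theorem IsLimitAlong.of_ne_bot {σ : PointedCone ℝ (Fin n → ℝ)} {x : AffineToric σ}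
    {y w : Fin n → ℝ} (h : IsLimitAlong x y w) {u : dualMonoid σ} (hu : x u ≠ ⊥) :
    toReal u.1 ⬝ᵥ w = 0 := by
  by_contra h0
  exact hu ((h u).2.2 (lt_of_le_of_ne (h u).1 (Ne.symm h0)))

theorem toReal_nsmul (N : ℕ) (a : Fin n → ℤ) : toReal (N • a) = (N : ℝ) • toReal a := by
  ext i; simp [toReal]

theorem toReal_zero : toReal (0 : Fin n → ℤ) = 0 := by
  ext i; simp [toReal]

/-- `S_τ` is `S_σ` with one element `k` inverted. The point is finite at `k`, so `k` vanishes on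
`w`, and the conditions at `u` follow from those at `u + N • k` by cancelling a finite value. -/
theorem IsLimitAlong.of_incl {τ σ : PointedCone ℝ (Fin n → ℝ)} (hσ : IsSmoothCone σ)
    (hτ : τ.IsFaceOf σ) {z : AffineToric τ} {y w : Fin n → ℝ}
    (h : IsLimitAlong (AffineToric.incl hτ.le z) y w) : IsLimitAlong z y w := by
  obtain ⟨k, hk, hk', hu⟩ := exists_sep' hσ hτ
  have hkτ := dualMonoid_anti hτ.le hk
  have hkb : z ⟨k, hkτ⟩ ≠ ⊥ := z.ne_bot hkτ hk'
  have hkw : toReal k ⬝ᵥ w = 0 := h.of_ne_bot (u := ⟨k, hk⟩) hkb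
  have hkz : z ⟨k, hkτ⟩ = ((toReal k ⬝ᵥ y : ℝ) : WithBot ℝ) := (h ⟨k, hk⟩).2.1 hkw
  intro u
  obtain ⟨N, hN⟩ := hu u.1 u.2
  have h1 := h ⟨_, hN⟩
  have h2 : AffineToric.incl hτ.le z ⟨u.1 + N • k, hN⟩ = z u + N • z ⟨k, hkτ⟩ := by
    rw [← map_nsmul, ← map_add]; rfl
  simp only [toReal_add, toReal_nsmul, add_dotProduct, smul_dotProduct, hkw, smul_zero,
    add_zero] at h1
  rw [h2] at h1
  refine ⟨h1.1, fun h3 => ?_, fun h3 => ?_⟩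
  · have h4 := h1.2.1 h3
    rw [hkz, ← WithBot.coe_nsmul, WithBot.coe_add, nsmul_eq_mul, smul_eq_mul] at h4
    exact trop_cancel WithBot.coe_ne_bot h4
  · exact (WithBot.add_eq_bot.1 (h1.2.2 h3)).resolve_right (nsmul_ne_bot hkb N)

theorem dual_expansion {b : Module.Basis (Fin n) ℤ (Fin n → ℤ)} {d : Fin n → (Fin n → ℤ)}
    (hd : ∀ i j, d i ⬝ᵥ b j = if i = j then 1 else 0) (u : Fin n → ℤ) :
    u = ∑ i, (u ⬝ᵥ b i) • d i := by
  have h : ∀ v : Fin n → ℤ, (u - ∑ i, (u ⬝ᵥ b i) • d i) ⬝ᵥ v = 0 := by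
    intro v
    rw [← b.sum_repr v, dotProduct_sum]
    refine Finset.sum_eq_zero fun j _ => ?_
    rw [dotProduct_smul, sub_dotProduct, sum_dotProduct]
    simp only [smul_dotProduct, hd]
    simp
  exact sub_eq_zero.1 (dotProduct_eq_zero _ h)

theorem mem_dualMonoid_dual {b : Module.Basis (Fin n) ℤ (Fin n → ℤ)} {d : Fin n → (Fin n → ℤ)}
    (hd : ∀ i j, d i ⬝ᵥ b j = if i = j then 1 else 0) (I : Set (Fin n)) (i : Fin n) :
    d i ∈ dualMonoid (basisCone b I) :=
  (mem_dualMonoid_basisCone _).2 fun j _ => by rw [hd]; split_ifs <;> simp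

open Classical in
/-- Every point of a smooth affine chart is a limit of inner points along a ray, given by its
coordinates. -/
theorem isLimitAlong_coordinates {b : Module.Basis (Fin n) ℤ (Fin n → ℤ)}
    {d : Fin n → (Fin n → ℤ)} (hd : ∀ i j, d i ⬝ᵥ b j = if i = j then 1 else 0) {I : Set (Fin n)}
    (x : AffineToric (basisCone b I)) :
    IsLimitAlong x
      (∑ i, (x ⟨d i, mem_dualMonoid_dual hd I i⟩).unbotD 0 • toReal (b i))
      (∑ i, if x ⟨d i, mem_dualMonoid_dual hd I i⟩ = ⊥ then toReal (b i) else 0) := by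
  let e : Fin n → dualMonoid (basisCone b I) := fun i => ⟨d i, mem_dualMonoid_dual hd I i⟩
  intro u
  have hu := (mem_dualMonoid_basisCone u.1).1 u.2
  -- For `i ∉ I` both `d i` and `-d i` lie in `S_σ`, so that coordinate is finite.
  have hI : ∀ i, x (e i) = ⊥ → i ∈ I := by
    intro i hi
    by_contra hiI
    refine x.ne_bot (mem_dualMonoid_dual hd I i) ((mem_dualMonoid_basisCone _).2 fun j hj => ?_) hi
    have hij : i ≠ j := fun h => hiI (h ▸ hj)
    simp [hd, hij]
  -- Moving the negative coefficients of `u` to the left leaves only natural multiples, to which the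
  -- monoid homomorphism `x` applies. By `hneg` the sum on the left involves no infinite coordinate,
  -- so it can be cancelled.
  have hx : x u + ∑ i, (-(u.1 ⬝ᵥ b i)).toNat • x (e i) = ∑ i, (u.1 ⬝ᵥ b i).toNat • x (e i) := by
    simp only [← map_nsmul, ← map_sum, ← map_add]
    congr 1
    ext1
    push_cast
    conv_lhs => enter [1]; rw [dual_expansion hd u.1]
    rw [← Finset.sum_add_distrib]
    refine Finset.sum_congr rfl fun i _ => ?_
    rw [← natCast_zsmul, ← natCast_zsmul, ← add_smul]
    congr 1
    omega
  have hw : toReal u.1 ⬝ᵥ (∑ i, if x (e i) = ⊥ then toReal (b i) else 0) =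
      ∑ i, if x (e i) = ⊥ then ((u.1 ⬝ᵥ b i : ℤ) : ℝ) else 0 := by
    rw [dotProduct_sum]
    refine Finset.sum_congr rfl fun i _ => ?_
    split_ifs
    · rw [toReal_dotProduct]
    · simp
  have hterm : ∀ i ∈ Finset.univ, (0 : ℝ) ≤ if x (e i) = ⊥ then ((u.1 ⬝ᵥ b i : ℤ) : ℝ) else 0 := by
    intro i _
    split_ifs with h
    · exact_mod_cast hu i (hI i h)
    · exact le_rfl
  have hneg : ∀ i, x (e i) = ⊥ → (-(u.1 ⬝ᵥ b i)).toNat = 0 := fun i h => by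
    have := hu i (hI i h)
    omega
  have hfin : ∀ N : Fin n → ℕ, (∀ i, x (e i) = ⊥ → N i = 0) →
      ∑ i, N i • x (e i) = ((∑ i, N i * (x (e i)).unbotD 0 : ℝ) : WithBot ℝ) := by
    intro N hN
    rw [WithBot.coe_sum]
    refine Finset.sum_congr rfl fun i _ => ?_
    by_cases h : x (e i) = ⊥
    · simp [hN i h]
    · obtain ⟨r, hr⟩ := WithBot.ne_bot_iff_exists.1 h
      rw [← hr, ← WithBot.coe_nsmul]
      simp
  rw [hfin _ hneg] at hx
  change 0 ≤ toReal u.1 ⬝ᵥ (∑ i, if x (e i) = ⊥ then toReal (b i) else 0) ∧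
    (toReal u.1 ⬝ᵥ (∑ i, if x (e i) = ⊥ then toReal (b i) else 0) = 0 → x u =
      ((toReal u.1 ⬝ᵥ ∑ i, (x (e i)).unbotD 0 • toReal (b i) : ℝ) : WithBot ℝ)) ∧
    (0 < toReal u.1 ⬝ᵥ (∑ i, if x (e i) = ⊥ then toReal (b i) else 0) → x u = ⊥)
  rw [hw]
  refine ⟨Finset.sum_nonneg hterm, fun h0 => ?_, fun hpos => ?_⟩
  · rw [Finset.sum_eq_zero_iff_of_nonneg hterm] at h0
    rw [hfin] at hx
    · refine trop_cancel WithBot.coe_ne_bot (hx.trans ?_)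
      rw [← WithBot.coe_add]
      congr 1
      rw [dotProduct_sum, ← Finset.sum_add_distrib]
      refine Finset.sum_congr rfl fun i _ => ?_
      rw [dotProduct_smul, toReal_dotProduct, smul_eq_mul]
      have h1 : ((u.1 ⬝ᵥ b i : ℤ) : ℝ) + ((-(u.1 ⬝ᵥ b i)).toNat : ℝ) = ((u.1 ⬝ᵥ b i).toNat : ℝ) := by
        have : (u.1 ⬝ᵥ b i) + ((-(u.1 ⬝ᵥ b i)).toNat : ℤ) = ((u.1 ⬝ᵥ b i).toNat : ℤ) := by omega
        exact_mod_cast this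
      rw [← h1]
      ring
    · intro i hi
      have := h0 i (Finset.mem_univ i)
      rw [if_pos hi] at this
      have : u.1 ⬝ᵥ b i = 0 := by exact_mod_cast this
      simp [this]
  · obtain ⟨i, -, hi⟩ := Finset.exists_ne_zero_of_sum_ne_zero hpos.ne'
    have hb : x (e i) = ⊥ := by
      by_contra h
      simp [h] at hi
    rw [if_pos hb] at hi
    have hge := hu i (hI i hb)
    have hne : u.1 ⬝ᵥ b i ≠ 0 := by exact_mod_cast hi
    have hS : ∑ i, (u.1 ⬝ᵥ b i).toNat • x (e i) = ⊥ := by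
      rw [← Finset.add_sum_erase _ _ (Finset.mem_univ i), hb]
      obtain ⟨N, hN⟩ : ∃ N, (u.1 ⬝ᵥ b i).toNat = N + 1 := ⟨(u.1 ⬝ᵥ b i).toNat - 1, by omega⟩
      rw [hN, succ_nsmul, WithBot.add_bot, WithBot.bot_add]
    rw [hS] at hx
    exact (WithBot.add_eq_bot.1 hx).resolve_right WithBot.coe_ne_bot

theorem exists_isLimitAlong {σ : PointedCone ℝ (Fin n → ℝ)} (hσ : IsSmoothCone σ)
    (x : AffineToric σ) : ∃ y w, IsLimitAlong x y w := by
  obtain ⟨b, I, rfl⟩ := hσ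
  obtain ⟨d, hd⟩ := exists_dual b
  exact ⟨_, _, isLimitAlong_coordinates hd x⟩

/-- Points of two charts that agree come from the intersection of the charts. -/
theorem Fan.IsSmooth.exists_of_chart_eq {Δ : Fan n} (hΔ : Δ.IsSmooth)
    {σ σ' : PointedCone ℝ (Fin n → ℝ)} (hσ : σ ∈ Δ.cones) (hσ' : σ' ∈ Δ.cones)
    {x : AffineToric σ} {x' : AffineToric σ'} (h : Δ.chart hσ x = Δ.chart hσ' x') :
    ∃ z : AffineToric (σ ⊓ σ'), AffineToric.incl inf_le_left z = x ∧
      AffineToric.incl inf_le_right z = x' := by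
  -- `Q` is invariant under a single gluing step, so it descends to the quotient; no description of
  -- the generated equivalence relation is needed.
  let Q : Δ.Pieces → Prop := fun a =>
    ∃ z : AffineToric (σ ⊓ a.1.1), AffineToric.incl inf_le_left z = x ∧
      AffineToric.incl inf_le_right z = a.2
  have hQ : ∀ a c : Δ.Pieces, Δ.glue a c → Q a → Q c := by
    rintro ⟨⟨α, hα⟩, xa⟩ ⟨⟨γ, hγ⟩, xc⟩ ⟨τ, hτ, ha, hc, z, hz, hz'⟩ ⟨w, hw', hw⟩
    dsimp only at ha hc z hz hz' w hw hw'
    obtain ⟨v, hv1, hv2⟩ := AffineToric.exists_inf (hΔ α hα) (Δ.isFaceOf_of_le hτ hα ha)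
      (Δ.inter_face σ hσ α hα).2 z w (hz.trans hw.symm)
    refine ⟨AffineToric.incl (le_inf (inf_le_right.trans inf_le_left)
      (inf_le_left.trans hc)) v, ?_, ?_⟩
    · rw [← hw', ← hv2]
      rfl
    · rw [← hz', ← hv1]
      rfl
  have hsymm : ∀ a c : Δ.Pieces, Δ.glue a c → Δ.glue c a := by
    rintro a c ⟨τ, hτ, ha, hc, z, hz, hz'⟩
    exact ⟨τ, hτ, hc, ha, z, hz', hz⟩
  have hiff : ∀ a c : Δ.Pieces, Δ.glue a c → Q a = Q c := fun a c h =>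
    propext ⟨hQ a c h, hQ c a (hsymm a c h)⟩
  have h1 : Quot.lift Q hiff (Δ.chart hσ x) = Quot.lift Q hiff (Δ.chart hσ' x') := by rw [h]
  have h2 : Q ⟨⟨σ, hσ⟩, x⟩ := ⟨AffineToric.incl (le_inf le_rfl le_rfl) x, rfl, rfl⟩
  have h3 : Q ⟨⟨σ, hσ⟩, x⟩ = Q ⟨⟨σ', hσ'⟩, x'⟩ := h1
  exact h3.mp h2

/-- Being the limit of `y - t w` depends on the point of the variety only. This matters because
regularity may be witnessed in any chart. -/
theorem Fan.IsSmooth.isLimitAlong_of_chart_eq {Δ : Fan n} (hΔ : Δ.IsSmooth)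
    {σ σ' : PointedCone ℝ (Fin n → ℝ)} (hσ : σ ∈ Δ.cones) (hσ' : σ' ∈ Δ.cones)
    {x : AffineToric σ} {x' : AffineToric σ'} (h : Δ.chart hσ x = Δ.chart hσ' x')
    {y w : Fin n → ℝ} (hx : IsLimitAlong x y w) : IsLimitAlong x' y w := by
  obtain ⟨z, rfl, rfl⟩ := hΔ.exists_of_chart_eq hσ hσ' h
  exact (IsLimitAlong.of_incl (hΔ σ hσ) (Δ.inter_face σ hσ σ' hσ').1 hx).incl inf_le_right

theorem continuous_chart (Δ : Fan n) {σ : PointedCone ℝ (Fin n → ℝ)} (hσ : σ ∈ Δ.cones) :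
    Continuous (Δ.chart hσ) :=
  continuous_quot_mk.comp (continuous_sigmaMk (σ := fun σ : {σ // σ ∈ Δ.cones} => AffineToric σ.1)
    (i := ⟨σ, hσ⟩))

theorem tendsto_withBot_bot {α : Type*} {l : Filter α} {f : α → ℝ} (hf : Tendsto f l atBot) :
    Tendsto (fun a => (f a : WithBot ℝ)) l (𝓝 ⊥) := by
  rw [WithBot.tendsto_nhds_bot_iff]
  intro r
  filter_upwards [hf.eventually (eventually_lt_atBot r)] with a ha
  exact_mod_cast ha

theorem tendsto_sub_smul (u y w : Fin n → ℝ) (hw : 0 < u ⬝ᵥ w) :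
    Tendsto (fun z : (Fin n → ℝ) × ℝ => u ⬝ᵥ (z.1 - z.2 • w)) (𝓝 y ×ˢ atTop) atBot := by
  have h1 : Tendsto (fun z : (Fin n → ℝ) × ℝ => u ⬝ᵥ z.1) (𝓝 y ×ˢ atTop) (𝓝 (u ⬝ᵥ y)) :=
    ((by fun_prop : Continuous fun z : Fin n → ℝ => u ⬝ᵥ z).tendsto y).comp tendsto_fst
  have h2 : Tendsto (fun z : (Fin n → ℝ) × ℝ => -(z.2 * (u ⬝ᵥ w))) (𝓝 y ×ˢ atTop) atBot :=
    tendsto_neg_atTop_atBot.comp ((tendsto_snd (f := 𝓝 y)).atTop_mul_const hw)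
  refine (h1.add_atBot h2).congr fun z => ?_
  rw [dotProduct_sub, dotProduct_smul, smul_eq_mul]
  ring

/-- The product filter lets the base point vary while `t → ∞`: a neighbourhood of a boundary point
catches `y' - t w` for all `y'` near `y` and all large `t`. The convexity argument in
`not_isRegularAt_neg` uses this uniformity. -/
theorem IsLimitAlong.tendsto {Δ : Fan n} {σ : PointedCone ℝ (Fin n → ℝ)} (hσ : σ ∈ Δ.cones)
    {x : AffineToric σ} {y w : Fin n → ℝ} (h : IsLimitAlong x y w) :
    Tendsto (fun z : (Fin n → ℝ) × ℝ => Δ.inner (z.1 - z.2 • w)) (𝓝 y ×ˢ atTop)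
      (𝓝 (Δ.chart hσ x)) := by
  simp only [Δ.inner_eq hσ]
  refine (continuous_chart Δ hσ).continuousAt.tendsto.comp ?_
  rw [nhds_induced, tendsto_comap_iff, tendsto_pi_nhds]
  intro u
  obtain ⟨h0, h1, h2⟩ := h u
  change Tendsto (fun z : (Fin n → ℝ) × ℝ =>
    ((toReal u.1 ⬝ᵥ (z.1 - z.2 • w) : ℝ) : WithBot ℝ)) (𝓝 y ×ˢ atTop) (𝓝 (x u))
  rcases h0.eq_or_lt with h0 | h0
  · rw [h1 h0.symm]
    simp only [dotProduct_sub, dotProduct_smul, ← h0, smul_zero, sub_zero]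
    exact ((WithBot.continuous_coe.comp (by fun_prop :
      Continuous fun z : Fin n → ℝ => toReal u.1 ⬝ᵥ z)).tendsto y).comp tendsto_fst
  · rw [h2 h0]
    exact tendsto_withBot_bot (tendsto_sub_smul _ y w h0)

/-! ## Asymptotics of regular functions -/

/-- The maximum of finitely many integral affine functions. -/
noncomputable def affineMax (s : Finset ((Fin n → ℤ) × ℝ)) (hs : s.Nonempty) (y : Fin n → ℝ) : ℝ :=
  s.sup' hs fun q => q.2 + toReal q.1 ⬝ᵥ y

/-- Near `y - t w`, for large `t`, the function `f` is a maximum of integral affine functions that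
are nonincreasing along `-w`. -/
def IsTropicalAlong (f : (Fin n → ℝ) → ℝ) (y w : Fin n → ℝ) : Prop :=
  ∃ (s : Finset ((Fin n → ℤ) × ℝ)) (hs : s.Nonempty), (∀ q ∈ s, 0 ≤ toReal q.1 ⬝ᵥ w) ∧
    ∀ᶠ z : (Fin n → ℝ) × ℝ in 𝓝 y ×ˢ atTop,
      f (z.1 - z.2 • w) = affineMax s hs (z.1 - z.2 • w)

/-- The exponents of a sum form a Minkowski sum. Working with this notion avoids adding regular
functions that are given in different charts. -/
theorem IsTropicalAlong.add {f g : (Fin n → ℝ) → ℝ} {y w : Fin n → ℝ}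
    (hf : IsTropicalAlong f y w) (hg : IsTropicalAlong g y w) : IsTropicalAlong (f + g) y w := by
  classical
  obtain ⟨s, hs, hsw, hfs⟩ := hf
  obtain ⟨t, ht, htw, hgt⟩ := hg
  refine ⟨(s ×ˢ t).image fun q => q.1 + q.2, (hs.product ht).image _, ?_, ?_⟩
  · intro q hq
    obtain ⟨⟨a, b⟩, hab, rfl⟩ := Finset.mem_image.1 hq
    rw [Finset.mem_product] at hab
    simp only [Prod.fst_add, toReal_add, add_dotProduct]
    exact add_nonneg (hsw _ hab.1) (htw _ hab.2)
  · filter_upwards [hfs, hgt] with z h1 h2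
    rw [Pi.add_apply, h1, h2]
    generalize z.1 - z.2 • w = v
    refine le_antisymm ?_ (Finset.sup'_le _ _ ?_)
    · obtain ⟨a, ha, ha'⟩ := s.exists_mem_eq_sup' hs fun q => q.2 + toReal q.1 ⬝ᵥ v
      obtain ⟨b, hb, hb'⟩ := t.exists_mem_eq_sup' ht fun q => q.2 + toReal q.1 ⬝ᵥ v
      rw [affineMax, affineMax, ha', hb']
      refine le_trans (le_of_eq ?_) (Finset.le_sup' _
        (Finset.mem_image.2 ⟨(a, b), Finset.mem_product.2 ⟨ha, hb⟩, rfl⟩))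
      simp only [Prod.fst_add, Prod.snd_add, toReal_add, add_dotProduct]
      ring
    · intro q hq
      obtain ⟨⟨a, b⟩, hab, rfl⟩ := Finset.mem_image.1 hq
      rw [Finset.mem_product] at hab
      have h3 := Finset.le_sup' (fun q : (Fin n → ℤ) × ℝ => q.2 + toReal q.1 ⬝ᵥ v) hab.1
      have h4 := Finset.le_sup' (fun q : (Fin n → ℤ) × ℝ => q.2 + toReal q.1 ⬝ᵥ v) hab.2
      simp only [Prod.fst_add, Prod.snd_add, toReal_add, add_dotProduct, affineMax]
      linarith

/-- The subtracted monomial `m` is finite at the point itself, hence vanishes on `w`. Dividing by it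
therefore keeps all exponents nonnegative on `w`. -/
theorem IsRegularAt.isTropicalAlong {Δ : Fan n} (hΔ : Δ.IsSmooth) {f : (Fin n → ℝ) → ℝ}
    {σ : PointedCone ℝ (Fin n → ℝ)} {hσ : σ ∈ Δ.cones} {x : AffineToric σ}
    (hf : IsRegularAt Δ f (Δ.chart hσ x)) {y w : Fin n → ℝ} (h : IsLimitAlong x y w) :
    IsTropicalAlong f y w := by
  classical
  obtain ⟨σ', hσ', V, hV, hpV, hVσ, g, m, c, hm, hfg⟩ := hf
  obtain ⟨x', hx'⟩ := hVσ hpV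
  have h' : IsLimitAlong x' y w := hΔ.isLimitAlong_of_chart_eq hσ hσ' hx'.symm h
  have hmw : toReal m.1 ⬝ᵥ w = 0 := h'.of_ne_bot (hm x' (hx' ▸ hpV))
  refine ⟨g.supp.image fun u => (u.1 - m.1, g.coeff u - c), g.nonempty.image _, ?_, ?_⟩
  · intro q hq
    obtain ⟨u, -, rfl⟩ := Finset.mem_image.1 hq
    rw [toReal_sub, sub_dotProduct, hmw, sub_zero]
    exact (h' u).1
  · filter_upwards [(h.tendsto hσ).eventually (hV.mem_nhds hpV)] with z hz
    rw [hfg _ hz, affineMax, Finset.sup'_image, TropPoly.eval]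
    generalize z.1 - z.2 • w = v
    refine le_antisymm ?_ (Finset.sup'_le _ _ fun u hu => ?_)
    · rw [sub_le_iff_le_add]
      refine Finset.sup'_le _ _ fun u hu => ?_
      have h3 := Finset.le_sup' ((fun q : (Fin n → ℤ) × ℝ => q.2 + toReal q.1 ⬝ᵥ v) ∘
        fun u : dualMonoid σ' => (u.1 - m.1, g.coeff u - c)) hu
      simp only [Function.comp_def, toReal_sub, sub_dotProduct] at h3 ⊢
      linarith
    · have h3 := Finset.le_sup' (fun u : dualMonoid σ' => g.coeff u + toReal u.1 ⬝ᵥ v) hu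
      simp only [Function.comp_def, toReal_sub, sub_dotProduct] at h3 ⊢
      linarith

/-- A function that is tropical along `y - t w` is bounded above there for large `t`. -/
theorem IsTropicalAlong.exists_le {f : (Fin n → ℝ) → ℝ} {y w : Fin n → ℝ}
    (hf : IsTropicalAlong f y w) : ∃ C, ∀ᶠ t : ℝ in atTop, f (y - t • w) ≤ C := by
  obtain ⟨s, hs, hsw, hfs⟩ := hf
  refine ⟨affineMax s hs y, ?_⟩
  have h1 : Tendsto (fun t : ℝ => (y, t)) atTop (𝓝 y ×ˢ atTop) :=
    tendsto_const_nhds.prodMk tendsto_id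
  filter_upwards [h1.eventually hfs, eventually_ge_atTop 0] with t ht ht0
  rw [ht]
  refine Finset.sup'_le _ _ fun q hq => ?_
  refine le_trans ?_ (Finset.le_sup' (fun q : (Fin n → ℤ) × ℝ => q.2 + toReal q.1 ⬝ᵥ y) hq)
  rw [dotProduct_sub, dotProduct_smul, smul_eq_mul]
  have := mul_nonneg ht0 (hsw q hq)
  linarith

theorem affineMax_midpoint (s : Finset ((Fin n → ℤ) × ℝ)) (hs : s.Nonempty) (y v : Fin n → ℝ) :
    2 * affineMax s hs y ≤ affineMax s hs (y + v) + affineMax s hs (y - v) := by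
  obtain ⟨a, ha, ha'⟩ := s.exists_mem_eq_sup' hs fun q => q.2 + toReal q.1 ⬝ᵥ y
  have h1 := Finset.le_sup' (fun q : (Fin n → ℤ) × ℝ => q.2 + toReal q.1 ⬝ᵥ (y + v)) ha
  have h2 := Finset.le_sup' (fun q : (Fin n → ℤ) × ℝ => q.2 + toReal q.1 ⬝ᵥ (y - v)) ha
  simp only [affineMax, ha']
  simp only [dotProduct_add, dotProduct_sub] at h1 h2 ⊢
  linarith

theorem continuous_affineMax (s : Finset ((Fin n → ℤ) × ℝ)) (hs : s.Nonempty) :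
    Continuous (affineMax s hs) :=
  Continuous.finset_sup'_apply hs fun q _ => by fun_prop

/-- Near an inner point, a regular function is a maximum of integral affine functions. -/
theorem IsRegularAt.eventuallyEq_affineMax {Δ : Fan n} (hΔ : Δ.IsSmooth) {f : (Fin n → ℝ) → ℝ}
    {y : Fin n → ℝ} (hf : IsRegularAt Δ f (Δ.inner y)) : ∃ s hs, f =ᶠ[𝓝 y] affineMax s hs := by
  obtain ⟨s, hs, -, h⟩ := IsRegularAt.isTropicalAlong hΔ hf (isLimitAlong_inner _ y)
  -- With `w = 0` the parameter `t` drops out, and any admissible `t` gives a neighbourhood of `y`.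
  simp only [smul_zero, sub_zero] at h
  obtain ⟨P, hP, Q, hQ, hPQ⟩ := eventually_prod_iff.1 h
  obtain ⟨t, ht⟩ := hQ.exists
  exact ⟨s, hs, hP.mono fun z hz => hPQ hz ht⟩

/-! ## Neighbourhoods of inner points -/

theorem AffineToric.inner_injective {σ : PointedCone ℝ (Fin n → ℝ)} (hσ : IsSmoothCone σ) :
    Function.Injective (AffineToric.inner σ) := by
  obtain ⟨b, I, rfl⟩ := hσ
  obtain ⟨d, hd⟩ := exists_dual b
  intro y y' h
  have h1 : ∀ i, toReal (d i) ⬝ᵥ (y - y') = 0 := fun i => by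
    have := DFunLike.congr_fun h ⟨d i, mem_dualMonoid_dual hd I i⟩
    rw [dotProduct_sub, sub_eq_zero]
    exact WithBot.coe_injective this
  have h2 : ∀ u : Fin n → ℤ, toReal u ⬝ᵥ (y - y') = 0 := fun u => by
    have : toReal u = ∑ i, ((u ⬝ᵥ b i : ℤ) : ℝ) • toReal (d i) := by
      conv_lhs => rw [dual_expansion hd u]
      ext j
      simp [toReal]
    rw [this, sum_dotProduct]
    exact Finset.sum_eq_zero fun i _ => by rw [smul_dotProduct, h1, smul_zero]
  refine sub_eq_zero.1 (funext fun i => ?_)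
  have := h2 (Pi.single i 1)
  have h3 : toReal (Pi.single i 1 : Fin n → ℤ) = Pi.single i 1 := by
    ext j; by_cases h : j = i <;> simp [toReal, h]
  rwa [h3, single_one_dotProduct] at this

/-- The inner points are cut out by finiteness of the coordinates `x (d i)`, and these coordinates
give a continuous inverse there. -/
theorem isOpen_range_inner {σ : PointedCone ℝ (Fin n → ℝ)} (hσ : IsSmoothCone σ)
    {B : Set (Fin n → ℝ)} (hB : IsOpen B) : IsOpen (AffineToric.inner σ '' B) := by
  classical
  have hinj := AffineToric.inner_injective hσ
  obtain ⟨b, I, rfl⟩ := hσ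
  obtain ⟨d, hd⟩ := exists_dual b
  let e : Fin n → dualMonoid (basisCone b I) := fun i => ⟨d i, mem_dualMonoid_dual hd I i⟩
  let A : Set (AffineToric (basisCone b I)) := {x | ∀ i, x (e i) ≠ ⊥}
  let Y : AffineToric (basisCone b I) → (Fin n → ℝ) :=
    fun x => ∑ i, (x (e i)).unbotD 0 • toReal (b i)
  have hA : IsOpen A := by
    have : A = ⋂ i, (fun x : AffineToric (basisCone b I) => x (e i)) ⁻¹' {⊥}ᶜ := by
      ext x; simp [A]
    rw [this]
    exact isOpen_iInter_of_finite fun i =>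
      isOpen_compl_singleton.preimage (AffineToric.continuous_eval _)
  have hY : ContinuousOn Y A := by
    refine continuousOn_finsetSum _ fun i _ => ContinuousOn.fun_smul ?_ continuousOn_const
    exact (WithBot.continuousOn_unbotD 0).comp (AffineToric.continuous_eval (e i)).continuousOn
      fun x hx => hx i
  have hAY : ∀ x ∈ A, AffineToric.inner _ (Y x) = x := by
    intro x hx
    have h := isLimitAlong_coordinates hd x
    have hw : (∑ i, if x (e i) = ⊥ then toReal (b i) else 0) = 0 :=
      Finset.sum_eq_zero fun i _ => if_neg (hx i)
    refine AddMonoidHom.ext fun u => ?_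
    exact ((h u).2.1 (by change toReal u.1 ⬝ᵥ (∑ i, if x (e i) = ⊥ then toReal (b i) else 0) = 0
                         rw [hw, dotProduct_zero])).symm
  convert hY.isOpen_inter_preimage hA hB using 1
  ext x
  constructor
  · rintro ⟨y, hy, rfl⟩
    have h : AffineToric.inner _ y ∈ A := fun i => WithBot.coe_ne_bot
    exact ⟨h, show Y _ ∈ B by rwa [hinj (hAY _ h)]⟩
  · rintro ⟨hxA, hxB⟩
    exact ⟨_, hxB, hAY x hxA⟩

/-- The open set `V` contains no boundary point, so every monomial is finite on it and regularity at
inner points can be tested in `N_ℝ`. -/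
theorem Fan.IsSmooth.exists_isOpen_inner {Δ : Fan n} (hΔ : Δ.IsSmooth) {B : Set (Fin n → ℝ)}
    (hB : IsOpen B) : ∃ V : Set Δ.Variety, IsOpen V ∧
      ∀ (σ : PointedCone ℝ (Fin n → ℝ)) (hσ : σ ∈ Δ.cones) (x : AffineToric σ),
        Δ.chart hσ x ∈ V ↔ x ∈ AffineToric.inner σ '' B := by
  let Q : Δ.Pieces → Prop := fun a => a.2 ∈ AffineToric.inner a.1.1 '' B
  have hQ : ∀ a c : Δ.Pieces, Δ.glue a c → Q a → Q c := by
    rintro ⟨⟨α, hα⟩, xa⟩ ⟨⟨γ, hγ⟩, xc⟩ ⟨τ, hτ, ha, hc, z, hz, hz'⟩ ⟨y, hy, hyx⟩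
    dsimp only at ha hc z hz hz' hyx
    refine ⟨y, hy, ?_⟩
    have hz'' : AffineToric.inner τ y = z :=
      AffineToric.incl_injective (hΔ α hα) (Δ.isFaceOf_of_le hτ hα ha) (hyx.trans hz.symm)
    rw [← hz', ← hz'']
    rfl
  have hsymm : ∀ a c : Δ.Pieces, Δ.glue a c → Δ.glue c a := by
    rintro a c ⟨τ, hτ, ha, hc, z, hz, hz'⟩
    exact ⟨τ, hτ, hc, ha, z, hz', hz⟩
  have hiff : ∀ a c : Δ.Pieces, Δ.glue a c → Q a = Q c := fun a c h =>
    propext ⟨hQ a c h, hQ c a (hsymm a c h)⟩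
  refine ⟨{p | Quot.lift Q hiff p}, ?_, fun σ hσ x => Iff.rfl⟩
  have h : IsOpen (Quot.mk Δ.glue ⁻¹' {p : Quot Δ.glue | Quot.lift Q hiff p}) := by
    rw [isOpen_sigma_iff]
    rintro ⟨σ, hσ⟩
    exact isOpen_range_inner (hΔ σ hσ) hB
  exact h

theorem exists_sub_mem_dualMonoid {σ : PointedCone ℝ (Fin n → ℝ)} (hσ : IsSmoothCone σ)
    (m : Fin n → ℤ) : ∃ a ∈ dualMonoid σ, ∃ b ∈ dualMonoid σ, m = a - b := by
  obtain ⟨b, I, rfl⟩ := id hσ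
  have hbot : (basisCone b ∅).IsFaceOf (basisCone b I) := isFaceOf_basisCone (Set.empty_subset I)
  obtain ⟨k, hk, -, hu⟩ := exists_sep' hσ hbot
  obtain ⟨N, hN⟩ := hu m ((mem_dualMonoid_basisCone m).2 fun i hi => hi.elim)
  exact ⟨_, hN, _, nsmul_mem hk N, by abel⟩

/-- A function that is integral affine near an inner point is regular there. -/
theorem Fan.IsSmooth.isRegularAt_inner {Δ : Fan n} (hΔ : Δ.IsSmooth) {f : (Fin n → ℝ) → ℝ}
    {y : Fin n → ℝ} {m : Fin n → ℤ} {c : ℝ} (h : ∀ᶠ z in 𝓝 y, f z = c + toReal m ⬝ᵥ z) :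
    IsRegularAt Δ f (Δ.inner y) := by
  obtain ⟨B, hBf, hB, hy⟩ := eventually_nhds_iff.1 h
  obtain ⟨V, hV, hVB⟩ := hΔ.exists_isOpen_inner hB
  obtain ⟨σ, hσ⟩ := Δ.nonempty
  have hinner : ∀ z, Δ.inner z ∈ V ↔ z ∈ B := fun z => by
    rw [Δ.inner_eq hσ, hVB]
    exact (AffineToric.inner_injective (hΔ σ hσ)).mem_set_image
  obtain ⟨a, ha, b, hb, rfl⟩ := exists_sub_mem_dualMonoid (hΔ σ hσ) m
  refine ⟨σ, hσ, V, hV, (hinner y).2 hy, fun p hp => ?_, TropPoly.monomial ⟨a, ha⟩ c, ⟨b, hb⟩, 0,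
    fun x hx => ?_, fun z hz => ?_⟩
  · obtain ⟨σ', hσ', x, rfl⟩ := Δ.exists_mem_chartSet p
    obtain ⟨z, -, rfl⟩ := (hVB σ' hσ' x).1 hp
    exact ⟨AffineToric.inner σ z, by rw [← Δ.inner_eq hσ, ← Δ.inner_eq hσ']⟩
  · obtain ⟨z, -, rfl⟩ := (hVB σ hσ x).1 hx
    exact WithBot.coe_ne_bot
  · rw [hBf z ((hinner z).1 hz), TropPoly.eval_monomial, toReal_sub, sub_dotProduct]
    ring

theorem Fan.IsSmooth.isInvertibleAt_inner {Δ : Fan n} (hΔ : Δ.IsSmooth) {f : (Fin n → ℝ) → ℝ}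
    {y : Fin n → ℝ} {m : Fin n → ℤ} {c : ℝ} (h : ∀ᶠ z in 𝓝 y, f z = c + toReal m ⬝ᵥ z) :
    IsInvertibleAt Δ f (Δ.inner y) :=
  ⟨hΔ.isRegularAt_inner h, hΔ.isRegularAt_inner (m := -m) (c := -c) <| h.mono fun z hz => by
    rw [Pi.neg_apply, hz, toReal_neg, neg_dotProduct]; ring⟩

/-! ## Integral subgradients -/

/-- `m` is a local integral subgradient of `f` at `y`. -/
def IsSubgradient (f : (Fin n → ℝ) → ℝ) (y : Fin n → ℝ) (m : Fin n → ℤ) : Prop :=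
  ∀ᶠ z in 𝓝 y, f y + toReal m ⬝ᵥ (z - y) ≤ f z

theorem IsSubgradient.add {f g : (Fin n → ℝ) → ℝ} {y : Fin n → ℝ} {m m' : Fin n → ℤ}
    (hf : IsSubgradient f y m) (hg : IsSubgradient g y m') : IsSubgradient (f + g) y (m + m') := by
  filter_upwards [hf, hg] with z h1 h2
  rw [Pi.add_apply, Pi.add_apply, toReal_add, add_dotProduct]
  linarith

theorem isSubgradient_linear (m : Fin n → ℤ) (y : Fin n → ℝ) :
    IsSubgradient (fun z => toReal m ⬝ᵥ z) y m :=
  Eventually.of_forall fun z => by rw [dotProduct_sub]; linarith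

theorem IsSubgradient.of_affineMax {f : (Fin n → ℝ) → ℝ} {y : Fin n → ℝ}
    {s : Finset ((Fin n → ℤ) × ℝ)} {hs : s.Nonempty} (h : f =ᶠ[𝓝 y] affineMax s hs)
    {q : (Fin n → ℤ) × ℝ} (hq : q ∈ s) (hy : affineMax s hs y = q.2 + toReal q.1 ⬝ᵥ y) :
    IsSubgradient f y q.1 := by
  filter_upwards [h] with z hz
  have h1 := Finset.le_sup' (fun q : (Fin n → ℤ) × ℝ => q.2 + toReal q.1 ⬝ᵥ z) hq
  rw [h.eq_of_nhds, hz, hy, dotProduct_sub]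
  simp only [affineMax] at h1 ⊢
  linarith

theorem IsRegularAt.continuousAt {Δ : Fan n} (hΔ : Δ.IsSmooth) {f : (Fin n → ℝ) → ℝ}
    {y : Fin n → ℝ} (hf : IsRegularAt Δ f (Δ.inner y)) : ContinuousAt f y := by
  obtain ⟨s, hs, h⟩ := hf.eventuallyEq_affineMax hΔ
  exact (continuous_affineMax s hs).continuousAt.congr h.symm

theorem IsRegularAt.exists_isSubgradient {Δ : Fan n} (hΔ : Δ.IsSmooth) {f : (Fin n → ℝ) → ℝ}
    {y : Fin n → ℝ} (hf : IsRegularAt Δ f (Δ.inner y)) : ∃ m, IsSubgradient f y m := by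
  obtain ⟨s, hs, h⟩ := hf.eventuallyEq_affineMax hΔ
  obtain ⟨q, hq, hq'⟩ := s.exists_mem_eq_sup' hs fun q => q.2 + toReal q.1 ⬝ᵥ y
  exact ⟨_, .of_affineMax h hq hq'⟩

/-- Near an inner point, a function that is a sum of two regular functions and is not invertible has
two subgradients. -/
theorem exists_two_subgradients {Δ : Fan n} (hΔ : Δ.IsSmooth) {f g : (Fin n → ℝ) → ℝ}
    {y : Fin n → ℝ} (hf : IsRegularAt Δ f (Δ.inner y)) (hg : IsRegularAt Δ g (Δ.inner y))
    (hinv : ¬ IsInvertibleAt Δ (f + g) (Δ.inner y)) :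
    ∃ m m', m ≠ m' ∧ IsSubgradient (f + g) y m ∧ IsSubgradient (f + g) y m' := by
  obtain ⟨s, hs, -, h⟩ := (IsRegularAt.isTropicalAlong hΔ hf (isLimitAlong_inner _ y)).add
    (IsRegularAt.isTropicalAlong hΔ hg (isLimitAlong_inner _ y))
  simp only [smul_zero, sub_zero] at h
  obtain ⟨P, hP, Q, hQ, hPQ⟩ := eventually_prod_iff.1 h
  obtain ⟨t, ht⟩ := hQ.exists
  have hfg : f + g =ᶠ[𝓝 y] affineMax s hs := hP.mono fun z hz => hPQ hz ht
  obtain ⟨q, hq, hq'⟩ := s.exists_mem_eq_sup' hs fun q => q.2 + toReal q.1 ⬝ᵥ y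
  by_contra! hcon
  -- With only one slope active at `y`, all other slopes are strictly below and stay below nearby.
  -- Terms of the same slope differ by constants only, so the function is affine near `y`, hence
  -- invertible.
  have hlt : ∀ r ∈ s, r.1 ≠ q.1 → r.2 + toReal r.1 ⬝ᵥ y < q.2 + toReal q.1 ⬝ᵥ y := by
    intro r hr hne
    have hle := Finset.le_sup' (fun q : (Fin n → ℤ) × ℝ => q.2 + toReal q.1 ⬝ᵥ y) hr
    rw [hq'] at hle
    refine lt_of_le_of_ne hle fun heq => ?_
    exact hcon _ _ hne (.of_affineMax hfg hr (hq'.trans heq.symm)) (.of_affineMax hfg hq hq')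
  have hle : ∀ r ∈ s, ∀ᶠ z in 𝓝 y, r.2 + toReal r.1 ⬝ᵥ z ≤ q.2 + toReal q.1 ⬝ᵥ z := by
    intro r hr
    by_cases hne : r.1 = q.1
    · refine Eventually.of_forall fun z => ?_
      have := Finset.le_sup' (fun q : (Fin n → ℤ) × ℝ => q.2 + toReal q.1 ⬝ᵥ y) hr
      rw [hq'] at this
      simp only [hne] at this ⊢
      linarith
    · have hcont : ∀ q : (Fin n → ℤ) × ℝ, Continuous fun z => q.2 + toReal q.1 ⬝ᵥ z := fun q => by
        fun_prop
      exact ((hcont r).continuousAt.eventually_lt (hcont q).continuousAt (hlt r hr hne)).mono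
        fun z hz => hz.le
  refine hinv (hΔ.isInvertibleAt_inner (m := q.1) (c := q.2) ?_)
  filter_upwards [hfg, (eventually_all_finset s).2 hle] with z h1 h2
  rw [h1]
  exact le_antisymm (Finset.sup'_le _ _ h2)
    (Finset.le_sup' (fun q : (Fin n → ℤ) × ℝ => q.2 + toReal q.1 ⬝ᵥ z) hq)

/-! ## The upper bound -/

open Classical in
/-- The limit in `U_σ` of the inner points `y - t w` for `t → ∞`, where `w ∈ σ`. -/
noncomputable def AffineToric.limit {σ : PointedCone ℝ (Fin n → ℝ)} (y : Fin n → ℝ) {w : Fin n → ℝ}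
    (hw : w ∈ σ) : AffineToric σ where
  toFun u := if toReal u.1 ⬝ᵥ w = 0 then ((toReal u.1 ⬝ᵥ y : ℝ) : WithBot ℝ) else ⊥
  map_zero' := by simp [toReal_zero]
  map_add' u u' := by
    have h1 : 0 ≤ toReal u.1 ⬝ᵥ w := u.2 w hw
    have h2 : 0 ≤ toReal u'.1 ⬝ᵥ w := u'.2 w hw
    have h3 : toReal (u + u').1 = toReal u.1 + toReal u'.1 := toReal_add _ _
    simp only [h3, add_dotProduct, add_eq_zero_iff_of_nonneg h1 h2]
    by_cases h4 : toReal u.1 ⬝ᵥ w = 0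
    · by_cases h5 : toReal u'.1 ⬝ᵥ w = 0 <;> simp [h4, h5]
    · simp [h4]

theorem AffineToric.isLimitAlong_limit {σ : PointedCone ℝ (Fin n → ℝ)} (y : Fin n → ℝ)
    {w : Fin n → ℝ} (hw : w ∈ σ) : IsLimitAlong (AffineToric.limit y hw) y w :=
  fun u => ⟨u.2 w hw, fun h => if_pos h, fun h => if_neg h.ne'⟩

/-- The given representatives of `E` and `D` need not be the convenient ones. A local function of
`E` is a regular one plus an invertible correction, and passing from `E` to `T` costs two more
corrections, one for linear equivalence and one for `D.Same T`. -/
theorem CartierDivisor.exists_of_mem_linearSystem {Δ : Fan n} {D E T : CartierDivisor Δ}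
    (hD : D.Same T) (hE : E ∈ D.linearSystem) :
    ∃ h : (Fin n → ℝ) → ℝ, ∀ p, ∀ P ∈ E.pairs, p ∈ P.1 → ∀ R ∈ T.pairs, p ∈ R.1 →
      ∃ f₁ f₂ g₁ g₂, IsRegularAt Δ f₁ p ∧ IsRegularAt Δ f₂ p ∧ IsRegularAt Δ g₁ p ∧
        IsRegularAt Δ g₂ p ∧ P.2 = f₁ + f₂ ∧ h + R.2 = P.2 + g₁ + g₂ := by
  obtain ⟨⟨E', hE', hreg⟩, h, -, hlin⟩ := hE
  refine ⟨h, fun p P hP hpP R hR hpR => ?_⟩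
  obtain ⟨P', hP', hpP'⟩ := E'.cover p
  obtain ⟨Q, hQ, hpQ⟩ := D.cover p
  refine ⟨P'.2, -(P'.2 - P.2), -(P.2 - (Q.2 + h)), -(Q.2 - R.2), hreg P' hP' p hpP',
    (hE' P' hP' P hP p ⟨hpP', hpP⟩).2, (hlin P hP Q hQ p ⟨hpP, hpQ⟩).2,
    (hD Q hQ R hR p ⟨hpQ, hpR⟩).2, by abel, by abel⟩

/-- The lattice points of the polyhedron `P_D`. -/
def Fan.IsSmooth.latticePoints {Δ : Fan n} (hΔ : Δ.IsSmooth) (a : Δ.Ray → ℤ) :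
    Set (Fin n → ℤ) :=
  {m | ∀ ρ : Δ.Ray, 0 ≤ m ⬝ᵥ hΔ.gen ρ + a ρ}

theorem Fan.IsSmooth.encard_polyhedron {Δ : Fan n} (hΔ : Δ.IsSmooth) (a : Δ.Ray → ℤ) :
    (hΔ.polyhedron a ∩ Set.range toReal).encard = (hΔ.latticePoints a).encard := by
  rw [← toReal_injective.encard_image (hΔ.latticePoints a)]
  congr 1
  ext x
  constructor
  · rintro ⟨hx, m, rfl⟩
    refine ⟨m, fun ρ => ?_, rfl⟩
    have := hx ρ
    rw [toReal_dotProduct] at this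
    exact_mod_cast this
  · rintro ⟨m, hm, rfl⟩
    refine ⟨fun ρ => ?_, m, rfl⟩
    rw [toReal_dotProduct]
    exact_mod_cast hm ρ

/-- Rational functions that define members of `|D|` are convex on `N_ℝ`, their subgradients are
lattice points of `P_D`, and there are two subgradients at each inner point of the support. -/
theorem Fan.IsSmooth.exists_convex_of_mem_linearSystem {Δ : Fan n} (hΔ : Δ.IsSmooth)
    {a : Δ.Ray → ℤ} {D E : CartierDivisor Δ} (hD : D.Same (hΔ.toricDivisor a))
    (hE : E ∈ D.linearSystem) :
    ∃ h : (Fin n → ℝ) → ℝ,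
      (∀ y m, IsSubgradient h y m → ∀ z, h y + toReal m ⬝ᵥ (z - y) ≤ h z) ∧
      (∀ y m, IsSubgradient h y m → m ∈ hΔ.latticePoints a) ∧
      (∀ y, ∃ m, IsSubgradient h y m) ∧
      (∀ y, E.Passes (Δ.inner y) → ∃ m m', m ≠ m' ∧ IsSubgradient h y m ∧ IsSubgradient h y m') := by
  obtain ⟨h, hh⟩ := CartierDivisor.exists_of_mem_linearSystem hD hE
  obtain ⟨σ, hσ⟩ := Δ.nonempty
  let ℓ := hΔ.localExponent a hσ
  have hloc : ∀ y, ∀ P ∈ E.pairs, Δ.inner y ∈ P.1 →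
      ∃ f₁ f₂ g, IsRegularAt Δ f₁ (Δ.inner y) ∧ IsRegularAt Δ f₂ (Δ.inner y) ∧ P.2 = f₁ + f₂ ∧
        ContinuousAt g y ∧ (∃ m, IsSubgradient g y m) ∧ h = f₁ + f₂ + g := by
    intro y P hP hy
    obtain ⟨f₁, f₂, g₁, g₂, hf₁, hf₂, hg₁, hg₂, e₁, e₂⟩ :=
      hh _ P hP hy _ ⟨σ, hσ, rfl⟩ (Δ.inner_eq hσ y ▸ ⟨_, rfl⟩)
    obtain ⟨m₁, hm₁⟩ := hg₁.exists_isSubgradient hΔ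
    obtain ⟨m₂, hm₂⟩ := hg₂.exists_isSubgradient hΔ
    refine ⟨f₁, f₂, g₁ + g₂ + fun z => toReal (-ℓ) ⬝ᵥ z, hf₁, hf₂, e₁, ?_,
      ⟨_, (hm₁.add hm₂).add (isSubgradient_linear _ _)⟩, ?_⟩
    · exact ((hg₁.continuousAt hΔ).add (hg₂.continuousAt hΔ)).add
        (by fun_prop : Continuous fun z => toReal (-ℓ) ⬝ᵥ z).continuousAt
    · rw [← e₁]
      funext z
      have := congrFun e₂ z
      simp only [Pi.add_apply, toReal_neg, neg_dotProduct] at this ⊢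
      linarith
  have hsub : ∀ y, ∃ m, IsSubgradient h y m := by
    intro y
    obtain ⟨P, hP, hy⟩ := E.cover (Δ.inner y)
    obtain ⟨f₁, f₂, g, hf₁, hf₂, -, -, ⟨m, hm⟩, e⟩ := hloc y P hP hy
    obtain ⟨m₁, hm₁⟩ := hf₁.exists_isSubgradient hΔ
    obtain ⟨m₂, hm₂⟩ := hf₂.exists_isSubgradient hΔ
    exact ⟨_, e ▸ (hm₁.add hm₂).add hm⟩
  have hcont : Continuous h := by
    rw [continuous_iff_continuousAt]
    intro y
    obtain ⟨P, hP, hy⟩ := E.cover (Δ.inner y)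
    obtain ⟨f₁, f₂, g, hf₁, hf₂, -, hg, -, e⟩ := hloc y P hP hy
    rw [e]
    exact ((hf₁.continuousAt hΔ).add (hf₂.continuousAt hΔ)).add hg
  have hglob : ∀ y m, IsSubgradient h y m → ∀ z, h y + toReal m ⬝ᵥ (z - y) ≤ h z :=
    fun y m hm => subgradient_of_local hcont
      (fun x => (hsub x).imp' toReal fun _ hm => hm) hm
  refine ⟨h, hglob, fun y m hm ρ => ?_, hsub, fun y hy => ?_⟩
  · have hρ : toReal (hΔ.gen ρ) ∈ ρ.1 := ((hΔ.gen_spec ρ).2 _).2 ⟨1, by simp⟩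
    have hlim := AffineToric.isLimitAlong_limit y hρ
    obtain ⟨P, hP, hpP⟩ := E.cover (Δ.chart ρ.2.1 (AffineToric.limit y hρ))
    obtain ⟨f₁, f₂, g₁, g₂, hf₁, hf₂, hg₁, hg₂, e₁, e₂⟩ :=
      hh _ P hP hpP _ ⟨ρ.1, ρ.2.1, rfl⟩ ⟨_, rfl⟩
    rw [e₁] at e₂
    obtain ⟨C, hC⟩ := ((((hf₁.isTropicalAlong hΔ hlim).add (hf₂.isTropicalAlong hΔ hlim)).add
      (hg₁.isTropicalAlong hΔ hlim)).add (hg₂.isTropicalAlong hΔ hlim)).exists_le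
    rw [← e₂] at hC
    by_contra! hneg
    have hneg' : ((m ⬝ᵥ hΔ.gen ρ : ℤ) : ℝ) + (a ρ : ℝ) < 0 := by exact_mod_cast hneg
    have htend : Tendsto (fun t : ℝ => t * (((m ⬝ᵥ hΔ.gen ρ : ℤ) : ℝ) + (a ρ : ℝ))) atTop atBot :=
      tendsto_id.atTop_mul_const_of_neg hneg'
    obtain ⟨t, ht1, ht2⟩ := (hC.and (htend.eventually (eventually_lt_atBot
      (h y + toReal (hΔ.localExponent a ρ.2.1) ⬝ᵥ y - C)))).exists
    have h1 := hglob y m hm (y - t • toReal (hΔ.gen ρ))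
    simp only [Pi.add_apply, dotProduct_sub, dotProduct_smul, smul_eq_mul, toReal_dotProduct,
      hΔ.localExponent_gen a ρ.2.1 ρ le_rfl] at ht1 h1
    linarith
  · obtain ⟨P, hP, hpP, hinv⟩ := hy
    obtain ⟨f₁, f₂, g, hf₁, hf₂, e₁, -, ⟨m, hm⟩, e⟩ := hloc y P hP hpP
    rw [e₁] at hinv
    obtain ⟨m₁, m₂, hne, h1, h2⟩ := exists_two_subgradients hΔ hf₁ hf₂ hinv
    exact ⟨m₁ + m, m₂ + m, fun h => hne (add_right_cancel h), e ▸ h1.add hm, e ▸ h2.add hm⟩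

/-- If `P_D` has `k` lattice points, there are `k` points that no member of `|D|` passes. -/
theorem Fan.IsSmooth.exists_not_passes {Δ : Fan n} (hΔ : Δ.IsSmooth) {a : Δ.Ray → ℤ}
    {D : CartierDivisor Δ} (hD : D.Same (hΔ.toricDivisor a)) {k : ℕ}
    (hk : (hΔ.latticePoints a).encard = k) :
    ∃ p : Fin k → Δ.Variety, ¬ ∃ E ∈ D.linearSystem, ∀ i, E.Passes (p i) := by
  obtain ⟨v, hv⟩ := exists_injective_dotProduct n
  -- Equally spaced points on the line through `v`; on this line distinct lattice slopes have
  -- distinct derivatives.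
  refine ⟨fun j => Δ.inner ((j : ℝ) • v), ?_⟩
  rintro ⟨E, hE, hpass⟩
  obtain ⟨h, hglob, hmem, hsub, htwo⟩ := hΔ.exists_convex_of_mem_linearSystem hD hE
  have hpair : ∀ j : Fin k, ∃ m m', toReal m ⬝ᵥ v < toReal m' ⬝ᵥ v ∧
      IsSubgradient h ((j : ℝ) • v) m ∧ IsSubgradient h ((j : ℝ) • v) m' := by
    intro j
    obtain ⟨m, m', hne, h1, h2⟩ := htwo _ (hpass j)
    rcases lt_or_gt_of_ne (fun e => hne (hv e)) with hlt | hlt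
    · exact ⟨m, m', hlt, h1, h2⟩
    · exact ⟨m', m, hlt, h2, h1⟩
  choose lo hi hlt hlo hhi using hpair
  -- Monotonicity of the derivative of a convex function along the line.
  have hmono : ∀ j j' : Fin k, j < j' → toReal (hi j) ⬝ᵥ v ≤ toReal (lo j') ⬝ᵥ v := by
    intro j j' hjj
    have h1 := hglob _ _ (hhi j) ((j' : ℝ) • v)
    have h2 := hglob _ _ (hlo j') ((j : ℝ) • v)
    simp only [← sub_smul, dotProduct_smul, smul_eq_mul] at h1 h2
    have h3 : (0 : ℝ) < j' - j := sub_pos.2 (by exact_mod_cast hjj)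
    nlinarith
  have hinj : Function.Injective hi := by
    intro j j' e
    rcases lt_trichotomy j j' with hjj | hjj | hjj
    · have := (hmono _ _ hjj).trans_lt (hlt j')
      rw [e] at this
      exact absurd this (lt_irrefl _)
    · exact hjj
    · have := (hmono _ _ hjj).trans_lt (hlt j)
      rw [e] at this
      exact absurd this (lt_irrefl _)
  -- The `k` upper slopes already exhaust the lattice points, but the lower slope at the first point
  -- lies strictly below all of them.
  have hrange : Set.range hi = hΔ.latticePoints a := by
    refine (Set.finite_range hi).eq_of_subset_of_encard_le
      (Set.range_subset_iff.2 fun j => hmem _ _ (hhi j)) ?_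
    rw [hk, ← Set.image_univ, hinj.encard_image, Set.encard_univ]
    simp
  -- Some slope always exists, which rules out `k = 0`: without lattice points `|D|` is empty.
  obtain ⟨m, hm⟩ := hsub 0
  obtain ⟨j₀, -⟩ := hrange.symm ▸ hmem _ _ hm
  let z : Fin k := ⟨0, j₀.pos⟩
  obtain ⟨j, hj⟩ := hrange.symm ▸ hmem _ _ (hlo z)
  have h1 := hlt z
  rw [← hj] at h1
  rcases (Nat.zero_le j.1).eq_or_lt with h0 | h0
  · have : j = z := Fin.ext h0.symm
    rw [this] at h1
    exact lt_irrefl _ h1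
  · have := (hmono z j h0).trans_lt (hlt j)
    linarith

/-! ## The lower bound -/

theorem exists_tropical_kernel_finset {ι α : Type*} [Fintype ι] (t : Finset α)
    (hcard : Fintype.card ι < t.card) (A : ι → α → WithBot ℝ) :
    ∃ c : α → WithBot ℝ, (∃ i ∈ t, c i ≠ ⊥) ∧
      ∀ j, ∀ i₀ ∈ t, A j i₀ + c i₀ ≠ ⊥ → ∃ i ∈ t, i ≠ i₀ ∧ A j i₀ + c i₀ ≤ A j i + c i := by
  classical
  obtain ⟨c, ⟨i, hi⟩, hc⟩ := exists_tropical_kernel (κ := t) (by simpa using hcard)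
    fun j i => A j i.1
  have key : ∀ i : t, (fun i => if h : i ∈ t then c ⟨i, h⟩ else ⊥ : α → WithBot ℝ) i.1 = c i :=
    fun i => dif_pos i.2
  refine ⟨fun i => if h : i ∈ t then c ⟨i, h⟩ else ⊥, ⟨i.1, i.2, by rwa [key]⟩,
    fun j i₀ hi₀ h => ?_⟩
  rw [key ⟨i₀, hi₀⟩] at h ⊢
  obtain ⟨i, hne, hle⟩ := hc j ⟨i₀, hi₀⟩ h
  exact ⟨i.1, i.2, fun e => hne (Subtype.ext e), by rwa [key]⟩

/-- The tropical Laurent polynomial `max (r m + ⟨m, y⟩)`, `m ∈ S`. -/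
noncomputable def laurentMax (S : Finset (Fin n → ℤ)) (hS : S.Nonempty) (r : (Fin n → ℤ) → ℝ)
    (y : Fin n → ℝ) : ℝ :=
  S.sup' hS fun m => r m + toReal m ⬝ᵥ y

theorem le_laurentMax {S : Finset (Fin n → ℤ)} (hS : S.Nonempty) (r : (Fin n → ℤ) → ℝ)
    (y : Fin n → ℝ) {m : Fin n → ℤ} (hm : m ∈ S) :
    r m + toReal m ⬝ᵥ y ≤ laurentMax S hS r y :=
  Finset.le_sup' (fun m => r m + toReal m ⬝ᵥ y) hm

/-- Multiplying by the monomial `e` turns a Laurent polynomial into a genuine polynomial on `U_σ`;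
`e` is the local equation of the divisor, or part of it. -/
theorem exists_tropPoly_eval {σ : PointedCone ℝ (Fin n → ℝ)} (S : Finset (Fin n → ℤ))
    (hS : S.Nonempty) (r : (Fin n → ℤ) → ℝ) (e : Fin n → ℤ)
    (he : ∀ m ∈ S, m + e ∈ dualMonoid σ) :
    ∃ g : TropPoly σ, ∀ y, g.eval y = laurentMax S hS r y + toReal e ⬝ᵥ y := by
  classical
  refine ⟨⟨S.attach.image fun m => ⟨m.1 + e, he m.1 m.2⟩, (hS.attach).image _,
    fun u => r (u.1 - e)⟩, fun y => le_antisymm ?_ ?_⟩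
  · refine Finset.sup'_le _ _ fun u hu => ?_
    obtain ⟨m, -, rfl⟩ := Finset.mem_image.1 hu
    have := le_laurentMax hS r y m.2
    simp only [add_sub_cancel_right, toReal_add, add_dotProduct]
    linarith
  · rw [← le_sub_iff_add_le]
    refine Finset.sup'_le _ _ fun m hm => ?_
    rw [le_sub_iff_add_le]
    refine le_trans (le_of_eq ?_) (Finset.le_sup' _ (Finset.mem_image.2
      ⟨⟨m, hm⟩, Finset.mem_attach _ _, rfl⟩))
    simp only [add_sub_cancel_right, toReal_add, add_dotProduct]
    ring

theorem IsRegularAt.isRationalAt {Δ : Fan n} {f : (Fin n → ℝ) → ℝ} {p : Δ.Variety}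
    (hf : IsRegularAt Δ f p) : IsRationalAt Δ f p := by
  obtain ⟨σ, hσ, V, hV, hp, hVσ, g, m, c, -, hfg⟩ := hf
  exact ⟨σ, hσ, V, hV, hp, hVσ, g, TropPoly.monomial m c, fun y hy => by
    rw [hfg y hy, TropPoly.eval_monomial]⟩

/-- The inequalities of `P_D` at the rays of `σ` say precisely that the monomial `m` is a regular
section of `D` over `U_σ`. -/
theorem Fan.IsSmooth.add_localExponent_mem {Δ : Fan n} (hΔ : Δ.IsSmooth) {a : Δ.Ray → ℤ}
    {m : Fin n → ℤ} (hm : m ∈ hΔ.latticePoints a) {σ : PointedCone ℝ (Fin n → ℝ)}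
    (hσ : σ ∈ Δ.cones) : m + hΔ.localExponent a hσ ∈ dualMonoid σ :=
  hΔ.mem_dualMonoid hσ _ fun ρ hρ => by
    rw [add_dotProduct, hΔ.localExponent_gen a hσ ρ hρ]
    exact hm ρ

theorem Fan.IsSmooth.isRegularAt_laurentMax_add {Δ : Fan n} (hΔ : Δ.IsSmooth) {a : Δ.Ray → ℤ}
    {S : Finset (Fin n → ℤ)} (hS : S.Nonempty) (hSa : ∀ m ∈ S, m ∈ hΔ.latticePoints a)
    (r : (Fin n → ℤ) → ℝ) {σ : PointedCone ℝ (Fin n → ℝ)} (hσ : σ ∈ Δ.cones) {p : Δ.Variety}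
    (hp : p ∈ Δ.chartSet hσ) :
    IsRegularAt Δ (laurentMax S hS r + fun y => toReal (hΔ.localExponent a hσ) ⬝ᵥ y) p := by
  obtain ⟨g, hg⟩ := exists_tropPoly_eval (σ := σ) S hS r (hΔ.localExponent a hσ)
    fun m hm => hΔ.add_localExponent_mem (hSa m hm) hσ
  refine ⟨σ, hσ, _, hΔ.isOpen_chartSet hσ, hp, subset_rfl, g, 0, 0, fun x _ => ?_, fun y _ => ?_⟩
  · rw [map_zero]; exact WithBot.zero_ne_bot
  · simp [hg, toReal_zero]

theorem Fan.IsSmooth.isRationalAt_laurentMax {Δ : Fan n} (hΔ : Δ.IsSmooth) {a : Δ.Ray → ℤ}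
    {S : Finset (Fin n → ℤ)} (hS : S.Nonempty) (hSa : ∀ m ∈ S, m ∈ hΔ.latticePoints a)
    (r : (Fin n → ℤ) → ℝ) (p : Δ.Variety) : IsRationalAt Δ (laurentMax S hS r) p := by
  obtain ⟨σ, hσ, hp⟩ := Δ.exists_mem_chartSet p
  obtain ⟨u, hu, v, hv, e⟩ := exists_sub_mem_dualMonoid (hΔ σ hσ) (hΔ.localExponent a hσ)
  obtain ⟨g, hg⟩ := exists_tropPoly_eval (σ := σ) S hS r u fun m hm => by
    have := add_mem (hΔ.add_localExponent_mem (hSa m hm) hσ) hv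
    rwa [e, add_assoc, sub_add_cancel] at this
  refine ⟨σ, hσ, _, hΔ.isOpen_chartSet hσ, hp, subset_rfl, g, TropPoly.monomial ⟨u, hu⟩ 0,
    fun y _ => ?_⟩
  rw [hg, TropPoly.eval_monomial]
  ring

/-- The divisor `∑ a_ρ D_ρ + div h` of a tropical Laurent polynomial `h` with exponents in
`P_D`. -/
noncomputable def Fan.IsSmooth.laurentDivisor {Δ : Fan n} (hΔ : Δ.IsSmooth) {a : Δ.Ray → ℤ}
    {S : Finset (Fin n → ℤ)} (hS : S.Nonempty) (hSa : ∀ m ∈ S, m ∈ hΔ.latticePoints a)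
    (r : (Fin n → ℤ) → ℝ) : CartierDivisor Δ where
  pairs := {P | ∃ (σ : PointedCone ℝ (Fin n → ℝ)) (hσ : σ ∈ Δ.cones),
    P = (Δ.chartSet hσ, laurentMax S hS r + fun y => toReal (hΔ.localExponent a hσ) ⬝ᵥ y)}
  isOpen := by
    rintro _ ⟨σ, hσ, rfl⟩
    exact hΔ.isOpen_chartSet hσ
  cover := fun p => by
    obtain ⟨σ, hσ, hp⟩ := Δ.exists_mem_chartSet p
    exact ⟨_, ⟨σ, hσ, rfl⟩, hp⟩
  rational := by
    rintro _ ⟨σ, hσ, rfl⟩ p hp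
    exact (hΔ.isRegularAt_laurentMax_add hS hSa r hσ hp).isRationalAt
  compat := by
    rintro _ ⟨σ, hσ, rfl⟩ _ ⟨σ', hσ', rfl⟩ p hp
    have := (hΔ.toricDivisor a).compat _ ⟨σ, hσ, rfl⟩ _ ⟨σ', hσ', rfl⟩ p hp
    rwa [← add_sub_add_left_eq_sub _ _ (laurentMax S hS r)] at this

theorem IsInvertibleAt.neg {Δ : Fan n} {f : (Fin n → ℝ) → ℝ} {p : Δ.Variety}
    (hf : IsInvertibleAt Δ f p) : IsInvertibleAt Δ (-f) p :=
  ⟨hf.2, by rw [neg_neg]; exact hf.1⟩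

theorem Fan.IsSmooth.laurentDivisor_mem_linearSystem {Δ : Fan n} (hΔ : Δ.IsSmooth)
    {a : Δ.Ray → ℤ} {D : CartierDivisor Δ} (hD : D.Same (hΔ.toricDivisor a))
    {S : Finset (Fin n → ℤ)} (hS : S.Nonempty) (hSa : ∀ m ∈ S, m ∈ hΔ.latticePoints a)
    (r : (Fin n → ℤ) → ℝ) : hΔ.laurentDivisor hS hSa r ∈ D.linearSystem := by
  refine ⟨⟨_, (hΔ.laurentDivisor hS hSa r).compat, ?_⟩, laurentMax S hS r,
    hΔ.isRationalAt_laurentMax hS hSa r, ?_⟩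
  · rintro _ ⟨σ, hσ, rfl⟩ p hp
    exact hΔ.isRegularAt_laurentMax_add hS hSa r hσ hp
  · rintro _ ⟨σ, hσ, rfl⟩ Q hQ p hp
    have := (hD Q hQ _ ⟨σ, hσ, rfl⟩ p ⟨hp.2, hp.1⟩).neg
    rwa [neg_sub, ← add_sub_add_left_eq_sub _ _ (laurentMax S hS r),
      add_comm _ Q.2] at this

/-- A tropical polynomial is not invertible at a point where the maximum is `-∞` or attained more
than once. -/
theorem Fan.IsSmooth.not_isRegularAt_neg {Δ : Fan n} (hΔ : Δ.IsSmooth)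
    {σ : PointedCone ℝ (Fin n → ℝ)} (hσ : σ ∈ Δ.cones) (x : AffineToric σ)
    {S : Finset (Fin n → ℤ)} (hS : S.Nonempty) (r : (Fin n → ℤ) → ℝ) (e : Fin n → ℤ)
    (he : ∀ m ∈ S, m + e ∈ dualMonoid σ)
    (hx : ∀ m₀ (h₀ : m₀ ∈ S), x ⟨m₀ + e, he m₀ h₀⟩ ≠ ⊥ → ∃ m, ∃ h : m ∈ S, m ≠ m₀ ∧
      x ⟨m₀ + e, he m₀ h₀⟩ + r m₀ ≤ x ⟨m + e, he m h⟩ + r m) :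
    ¬ IsRegularAt Δ (-(laurentMax S hS r + fun y => toReal e ⬝ᵥ y)) (Δ.chart hσ x) := by
  classical
  intro hreg
  -- The terms finite at `x` are those whose exponent vanishes on `w`; the others tend to `-∞` along
  -- `y - t w`.
  obtain ⟨y, w, hyw⟩ := exists_isLimitAlong (hΔ σ hσ) x
  have htrop := hreg.isTropicalAlong hΔ hyw
  let φ : (Fin n → ℤ) → (Fin n → ℝ) → ℝ := fun m z => r m + toReal (m + e) ⬝ᵥ z
  have hφF : ∀ m ∈ S, ∀ z, φ m z ≤ laurentMax S hS r z + toReal e ⬝ᵥ z := by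
    intro m hm z
    have := le_laurentMax hS r z hm
    simp only [φ, toReal_add, add_dotProduct]
    linarith
  have hFφ : ∀ z C, (∀ m ∈ S, φ m z ≤ C) → laurentMax S hS r z + toReal e ⬝ᵥ z ≤ C := by
    intro z C h
    rw [← le_sub_iff_add_le]
    refine Finset.sup'_le _ _ fun m hm => ?_
    have := h m hm
    simp only [φ, toReal_add, add_dotProduct] at this
    linarith
  have hφt : ∀ m t, φ m (y - t • w) = φ m y - t * (toReal (m + e) ⬝ᵥ w) := by
    intro m t
    simp only [φ, dotProduct_sub, dotProduct_smul, smul_eq_mul]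
    ring
  have hφlim : ∀ m, 0 < toReal (m + e) ⬝ᵥ w → ∀ C, ∀ᶠ t : ℝ in atTop, φ m (y - t • w) ≤ C := by
    intro m hm C
    simp only [hφt]
    filter_upwards [(tendsto_id.atTop_mul_const hm).eventually (eventually_ge_atTop (φ m y - C))]
      with t ht
    simp only [id] at ht
    linarith
  have hev : ∀ C, (∀ m ∈ S, toReal (m + e) ⬝ᵥ w = 0 → φ m y ≤ C) →
      ∀ᶠ t : ℝ in atTop, laurentMax S hS r (y - t • w) + toReal e ⬝ᵥ (y - t • w) ≤ C := by
    intro C hC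
    have : ∀ m ∈ S, ∀ᶠ t : ℝ in atTop, φ m (y - t • w) ≤ C := by
      intro m hm
      rcases (hyw ⟨m + e, he m hm⟩).1.eq_or_lt with h0 | h0
      · refine Eventually.of_forall fun t => ?_
        rw [hφt, ← h0, mul_zero, sub_zero]
        exact hC m hm h0.symm
      · exact hφlim m h0 C
    filter_upwards [(eventually_all_finset S).2 this] with t ht using hFφ _ _ ht
  by_cases hS0 : ∃ m ∈ S, toReal (m + e) ⬝ᵥ w = 0
  · obtain ⟨m₀, hm₀, hmax⟩ := (S.filter fun m => toReal (m + e) ⬝ᵥ w = 0).exists_max_image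
      (fun m => φ m y) (by obtain ⟨m, hm, h⟩ := hS0; exact ⟨m, by simp [hm, h]⟩)
    rw [Finset.mem_filter] at hm₀
    have hval : ∀ m (hm : m ∈ S), toReal (m + e) ⬝ᵥ w = 0 →
        x ⟨m + e, he m hm⟩ + r m = ((φ m y : ℝ) : WithBot ℝ) := by
      intro m hm h
      rw [(hyw ⟨m + e, he m hm⟩).2.1 h, ← WithBot.coe_add, add_comm]
    obtain ⟨m₁, hm₁, hne, hle⟩ := hx m₀ hm₀.1 (by
      rw [(hyw ⟨m₀ + e, he m₀ hm₀.1⟩).2.1 hm₀.2]; exact WithBot.coe_ne_bot)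
    rw [hval m₀ hm₀.1 hm₀.2] at hle
    have hm₁w : toReal (m₁ + e) ⬝ᵥ w = 0 := by
      refine hyw.of_ne_bot (u := ⟨m₁ + e, he m₁ hm₁⟩) fun h => ?_
      rw [h, WithBot.bot_add, le_bot_iff] at hle
      exact WithBot.coe_ne_bot hle
    rw [hval m₁ hm₁ hm₁w, WithBot.coe_le_coe] at hle
    obtain ⟨s, hs, -, hF⟩ := htrop
    obtain ⟨P, hP, Q, hQ, hPQ⟩ := eventually_prod_iff.1 hF
    -- Moving by `ε v` favours `m₀`, and by `-ε v` favours `m₁`. Both terms are maximal at `y`, so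
    -- the two values add up to strictly more than twice the middle value, against midpoint
    -- convexity of the negative. For large `t` only terms finite at `x` matter in the middle.
    let v : Fin n → ℝ := toReal (m₀ - m₁)
    have hv : 0 < toReal (m₀ - m₁) ⬝ᵥ v := by
      have h0 : v ≠ 0 := fun h => hne (sub_eq_zero.1
        (toReal_injective (h.trans toReal_zero.symm))).symm
      exact lt_of_le_of_ne (Finset.sum_nonneg fun i _ => mul_self_nonneg _)
        fun h => h0 (dotProduct_self_eq_zero.1 h.symm)
    have hlim : ∀ d : Fin n → ℝ, ∀ᶠ ε : ℝ in 𝓝[>] 0, P (y + ε • d) := by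
      intro d
      have : Tendsto (fun ε : ℝ => y + ε • d) (𝓝[>] 0) (𝓝 y) := by
        have := ((by fun_prop : Continuous fun ε : ℝ => y + ε • d).tendsto 0).mono_left
          (nhdsWithin_le_nhds (s := Set.Ioi 0))
        simpa using this
      exact this.eventually hP
    obtain ⟨ε, ⟨hε1, hε2⟩, hε⟩ := (((hlim v).and (hlim (-v))).and self_mem_nhdsWithin).exists
    obtain ⟨t, ht1, ht2⟩ := (hQ.and (hev (φ m₀ y) fun m hm h =>
      hmax m (Finset.mem_filter.2 ⟨hm, h⟩))).exists
    have e0 := hPQ hP.self_of_nhds ht1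
    have e1 := hPQ hε1 ht1
    have e2 := hPQ hε2 ht1
    have hmid := affineMax_midpoint s hs (y - t • w) (ε • v)
    have c1 : y - t • w + ε • v = y + ε • v - t • w := by abel
    have c2 : y - t • w - ε • v = y + ε • (-v) - t • w := by rw [smul_neg]; abel
    rw [c1, c2, ← e0, ← e1, ← e2] at hmid
    have b1 := hφF m₀ hm₀.1 (y + ε • v - t • w)
    have b2 := hφF m₁ hm₁ (y + ε • (-v) - t • w)
    simp only [φ, dotProduct_sub, dotProduct_add, dotProduct_smul, hm₀.2, hm₁w,
      smul_eq_mul, dotProduct_neg] at b1 b2 hle ht2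
    simp only [Pi.neg_apply, Pi.add_apply, dotProduct_sub, dotProduct_add, dotProduct_smul,
      smul_eq_mul, dotProduct_neg] at hmid
    have hv' : 0 < ε * (toReal (m₀ + e) ⬝ᵥ v - toReal (m₁ + e) ⬝ᵥ v) := by
      refine mul_pos hε ?_
      rw [toReal_add, toReal_add, add_dotProduct, add_dotProduct, add_sub_add_right_eq_sub,
        ← sub_dotProduct, ← toReal_sub]
      exact hv
    linarith
  -- All terms are `-∞` at `x`: the polynomial tends to `-∞`, but a regular negative would be
  -- bounded above.
  · obtain ⟨C, hC⟩ := htrop.exists_le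
    obtain ⟨t, ht1, ht2⟩ := (hC.and (hev (-C - 1) fun m hm h => absurd ⟨m, hm, h⟩ hS0)).exists
    simp only [Pi.neg_apply, Pi.add_apply] at ht1
    linarith

/-- If `P_D` has more than `k` lattice points, any `k` points lie on a member of `|D|`. -/
theorem Fan.IsSmooth.exists_passes {Δ : Fan n} (hΔ : Δ.IsSmooth) {a : Δ.Ray → ℤ}
    {D : CartierDivisor Δ} (hD : D.Same (hΔ.toricDivisor a)) {k : ℕ}
    (hk : (k : ℕ∞) < (hΔ.latticePoints a).encard) (p : Fin k → Δ.Variety) :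
    ∃ E ∈ D.linearSystem, ∀ i, E.Passes (p i) := by
  classical
  obtain ⟨T, hTa, hT⟩ := Set.exists_subset_encard_eq (Order.add_one_le_of_lt hk)
  have hTfin : T.Finite := Set.finite_of_encard_eq_coe (k := k + 1) (by exact_mod_cast hT)
  lift T to Finset (Fin n → ℤ) using hTfin
  have hcard : k < T.card := by
    rw [Set.encard_coe_eq_coe_finsetCard] at hT
    have : T.card = k + 1 := by exact_mod_cast hT
    omega
  choose σ hσ x hx using fun j => Δ.exists_mem_chartSet (p j)
  -- Row `j` lists the values at `p j` of the monomial sections of `D`. The default `⊥` never occurs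
  -- for `m ∈ T`, since `T` consists of lattice points of `P_D`.
  let A : Fin k → (Fin n → ℤ) → WithBot ℝ := fun j m =>
    if h : m + hΔ.localExponent a (hσ j) ∈ dualMonoid (σ j) then x j ⟨_, h⟩ else ⊥
  obtain ⟨c, ⟨m, hm, hcm⟩, hc⟩ := exists_tropical_kernel_finset T (by simpa using hcard) A
  -- A tropical polynomial has real coefficients, so terms with coefficient `⊥` are dropped; `hm₁S`
  -- below shows that a competitor of a finite term is never dropped.
  let S := T.filter fun m => c m ≠ ⊥
  have hS : S.Nonempty := ⟨m, Finset.mem_filter.2 ⟨hm, hcm⟩⟩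
  have hSa : ∀ m ∈ S, m ∈ hΔ.latticePoints a := fun m hm => hTa (Finset.mem_filter.1 hm).1
  let r : (Fin n → ℤ) → ℝ := fun m => (c m).unbotD 0
  have hr : ∀ m ∈ S, ((r m : ℝ) : WithBot ℝ) = c m := fun m hm => by
    obtain ⟨s, hs⟩ := WithBot.ne_bot_iff_exists.1 (Finset.mem_filter.1 hm).2
    simp [r, ← hs]
  refine ⟨hΔ.laurentDivisor hS hSa r, hΔ.laurentDivisor_mem_linearSystem hD hS hSa r, fun j => ?_⟩
  have he : ∀ m ∈ S, m + hΔ.localExponent a (hσ j) ∈ dualMonoid (σ j) :=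
    fun m hm => hΔ.add_localExponent_mem (hSa m hm) (hσ j)
  have hA : ∀ m (hm : m ∈ S), A j m = x j ⟨_, he m hm⟩ := fun m hm => dif_pos (he m hm)
  refine ⟨_, ⟨σ j, hσ j, rfl⟩, ⟨x j, hx j⟩, fun hinv => ?_⟩
  have hreg := hinv.2
  rw [← hx j] at hreg
  refine hΔ.not_isRegularAt_neg (hσ j) (x j) hS r _ he (fun m₀ hm₀ h₀ => ?_) hreg
  have h1 : A j m₀ + c m₀ ≠ ⊥ := by
    rw [hA m₀ hm₀, ← hr m₀ hm₀]
    exact WithBot.add_ne_bot.2 ⟨h₀, WithBot.coe_ne_bot⟩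
  obtain ⟨m₁, hm₁, hne, hle⟩ := hc j m₀ (Finset.mem_filter.1 hm₀).1 h1
  have hm₁S : m₁ ∈ S := by
    refine Finset.mem_filter.2 ⟨hm₁, fun h => ?_⟩
    rw [h, WithBot.add_bot, le_bot_iff] at hle
    exact h1 hle
  refine ⟨m₁, hm₁S, hne, ?_⟩
  rwa [hA m₀ hm₀, hA m₁ hm₁S, ← hr m₀ hm₀, ← hr m₁ hm₁S] at hle

end TropToric

/-! ### Combination of the two bounds. -/

theorem mainTheorem4 (n : ℕ) (Δ : TropToric.Fan n) (hΔ : Δ.IsSmooth) (a : Δ.Ray → ℤ)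
    (D : TropToric.CartierDivisor Δ) (hD : D.Same (hΔ.toricDivisor a)) :
    D.h0 = (hΔ.polyhedron a ∩ Set.range TropToric.toReal).encard := by
  rw [hΔ.encard_polyhedron]
  refine le_antisymm ?_ (le_sInf ?_)
  -- Only a finite count needs a configuration of points; in the infinite case the lower bound alone
  -- determines the value.
  · rcases eq_or_ne (hΔ.latticePoints a).encard ⊤ with h | h
    · rw [h]
      exact le_top
    · lift (hΔ.latticePoints a).encard to ℕ using h with k hk
      exact sInf_le ⟨k, rfl, hΔ.exists_not_passes hD hk.symm⟩
  · rintro _ ⟨k, rfl, p, hp⟩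
    by_contra! hlt
    exact hp (hΔ.exists_passes hD hlt p)
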